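/- Let $K$ be a field, let $B$ be a finite dimensional, non-semisimple $K$-algebra, let $M$ be a finite dimensional right $B$-module which is a generator-cogenerator (every finite dimensional right $B$-module is a quotient of some $M^n$ and embeds into some $M^n$), let $A=\operatorname{End}_B(M)$, and let $d\ge 2$ be an integer. All modules are finite dimensional right modules. The dominant dimension of a module $X$ with minimal injective resolution $0\to X\to I_0\to I_1\to\cdots$ is $\sup\{n\ge 0\mid I_i\text{ is projective for all }0\le i<n\}\in\{0,1,2,\dots\}\cup\{\infty\}$, and the dominant dimension of $A$ is that of the regular module $A_A$. Let $\operatorname{proj}(A)$ be the class of projective $A$-modules and $\operatorname{Dom}_d(A)$ the class of $A$-modules of dominant dimension at least $d$. Let $\operatorname{add}(M)$ be the class of direct summands of the modules $M^n$; $M$ is called maximal $n$-orthogonal if $$\operatorname{add}(M)=\{X\mid \operatorname{Ext}^i_B(Y,X)=0\ \text{for all}\ Y\in\operatorname{add}(M),\ 1\le i\le n\}=\{X\mid \operatorname{Ext}^i_B(X,Y)=0\ \text{for all}\ Y\in\operatorname{add}(M),\ 1\le i\le n\}$$ (for $n=0$ the condition on $\operatorname{Ext}$ is empty). Then the following are equivalent: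 1. $\operatorname{proj}(A)=\operatorname{Dom}_d(A)$. 2. $A$ has dominant dimension equal to $d$ and global dimension equal to $d$. 3. $M$ is maximal $(d-2)$-orthogonal. -/

import Mathlib

universe u w

namespace DomDim

open CategoryTheory CategoryTheory.Abelian

section Modules

/- All notions are set up for left modules over a ring `R`.  Right modules over a ring `S` are the
modules over `R = Sᵐᵒᵖ`. -/
variable {R : Type u} [Ring R]

/-- An injective resolution `0 → X → I⁰ → I¹ → ⋯` is minimal if every `Iⁿ` is an essential extension
of the kernel of `Iⁿ → Iⁿ⁺¹`, that is, every nonzero submodule of `Iⁿ` meets this kernel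
nontrivially.  (By exactness the kernel is the image of `X` for `n = 0`, and the image of
`Iⁿ⁻¹ → Iⁿ` for `n > 0`, so that `Iⁿ` is its injective hull.) -/
def IsMinimal {X : ModuleCat.{u} R} (I : InjectiveResolution X) : Prop :=
  ∀ (n : ℕ) (N : Submodule R (I.cocomplex.X n)),
    N ⊓ LinearMap.ker (I.cocomplex.d n (n + 1)).hom = ⊥ → N = ⊥

/-- The dominant dimension of `X`: the number of terms (possibly `∞`) before the first nonprojective
term `Iⁱ` of a minimal injective resolution of `X`; this is `0` if `I⁰` is not projective, and
`sup {n | Iⁱ is projective for i = 0, …, n} + 1` otherwise.  Minimal injective resolutions exist and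
are unique up to isomorphism, so the supremum over `I` is the common value for all of them. -/
noncomputable def domDim (X : ModuleCat.{u} R) : ℕ∞ :=
  ⨆ (I : InjectiveResolution X) (_ : IsMinimal I) (n : ℕ)
    (_ : ∀ i < n, Projective (I.cocomplex.X i)), (n : ℕ∞)

variable (R) in
/-- `Dom_d`: the finitely generated modules of dominant dimension at least `d`. -/
def Dom (d : ℕ) : ObjectProperty (ModuleCat.{u} R) :=
  fun X => Module.Finite R X ∧ (d : ℕ∞) ≤ domDim X

variable (R) in
/-- `proj`: the finitely generated projective modules. -/
def proj : ObjectProperty (ModuleCat.{u} R) :=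
  fun X => Module.Finite R X ∧ Projective X

variable (R) in
/-- The global dimension: the supremum of the projective dimensions of the finitely generated
modules (`⊥` for the zero ring, where the zero module is the only one). -/
noncomputable def glDim : WithBot ℕ∞ :=
  ⨆ (X : ModuleCat.{u} R) (_ : Module.Finite R X), projectiveDimension X

/-- `add M`: the direct summands of the finite direct sums `Mⁿ`. -/
def add (M : ModuleCat.{u} R) : ObjectProperty (ModuleCat.{u} R) :=
  fun X => ∃ n : ℕ, Nonempty (Retract X (ModuleCat.of R (Fin n → M)))

/-- `𝒳^{⊥ n}`: the finitely generated `X` with `Extⁱ(Y, X) = 0` for all `Y ∈ 𝒳`, `1 ≤ i ≤ n`. -/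
def rightPerp (P : ObjectProperty (ModuleCat.{u} R)) (n : ℕ) : ObjectProperty (ModuleCat.{u} R) :=
  fun X => Module.Finite R X ∧ ∀ Y, P Y → ∀ i, 1 ≤ i → i ≤ n → Subsingleton (Ext Y X i)

/-- `^{⊥ n}𝒳`: the finitely generated `X` with `Extⁱ(X, Y) = 0` for all `Y ∈ 𝒳`, `1 ≤ i ≤ n`. -/
def leftPerp (P : ObjectProperty (ModuleCat.{u} R)) (n : ℕ) : ObjectProperty (ModuleCat.{u} R) :=
  fun X => Module.Finite R X ∧ ∀ Y, P Y → ∀ i, 1 ≤ i → i ≤ n → Subsingleton (Ext X Y i)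

/-- `M` is maximal `n`-orthogonal: `add M = M^{⊥ n} = ^{⊥ n}M`. -/
def IsMaximalOrthogonal (M : ModuleCat.{u} R) (n : ℕ) : Prop :=
  add M = rightPerp (add M) n ∧ add M = leftPerp (add M) n

/-- Every finitely generated module is a quotient of some `Mⁿ`. -/
def IsGenerator (M : ModuleCat.{u} R) : Prop :=
  ∀ X : ModuleCat.{u} R, Module.Finite R X →
    ∃ (n : ℕ) (f : (Fin n → M) →ₗ[R] X), Function.Surjective f

/-- Every finitely generated module embeds into some `Mⁿ`. -/
def IsCogenerator (M : ModuleCat.{u} R) : Prop :=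
  ∀ X : ModuleCat.{u} R, Module.Finite R X →
    ∃ (n : ℕ) (f : X →ₗ[R] (Fin n → M)), Function.Injective f

end Modules

section Algebras

variable (A : Type u) [Ring A]

/-- The dominant dimension of a ring: that of the regular right module `A_A`. -/
noncomputable def algDomDim : ℕ∞ := domDim (ModuleCat.of Aᵐᵒᵖ A)

end Algebras

end DomDim

/-!
A module has dominant dimension at least `n` exactly when it is the start of an exact sequence with
`n` further terms, all of them projective and injective; this description needs no minimality, so
dominant dimension can be tracked along short exact sequences.

(1) ⇔ (2): if `proj A = Dom_d A`, then `A` has dominant dimension at least `d`, hence so have all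
`d`-th syzygies; these are therefore projective, and the global dimension is at most `d`. If the
dominant dimension exceeds the global dimension, then the coresolution of `A` splits, so `A` is
injective and every module of finite projective dimension is projective, which makes `A` semisimple.
Conversely, a module of dominant dimension at least `d` is a `d`-th syzygy.

(1) ⇔ (3): `Hom_B(M, -)` is fully faithful and has an exact left adjoint (Gabriel–Popescu). The
modules of dominant dimension at least `2` are those in its image, and `Hom_B(M, X)` has dominant
dimension at least `n + 2` exactly when `Ext^i_B(M, X) = 0` for `1 ≤ i ≤ n`. So (1) says that
`add M` is the right perpendicular class of `M`. The left perpendicular class then comes for free: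
approximations by `add M` stay exact under `Hom_B(M, -)`, so they shift the vanishing of `Ext` into
the degrees that the right perpendicular condition controls.
-/

namespace DomDim

open CategoryTheory CategoryTheory.Abelian CategoryTheory.Limits

section EssentialExtension

section Lattice

variable {α : Type*} [CompleteLattice α]

/-- In the lattice of subobjects of an object: `e` is an essential extension of `x`. -/
def IsEssentialIn (x e : α) : Prop :=
  x ≤ e ∧ ∀ y ≤ e, Disjoint y x → y = ⊥

theorem IsEssentialIn.trans {x e f : α} (hxe : IsEssentialIn x e) (hef : IsEssentialIn e f) :
    IsEssentialIn x f :=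
  ⟨hxe.1.trans hef.1, fun y hy hyx => hef.2 y hy <| disjoint_iff.2 <|
    hxe.2 _ inf_le_right (hyx.mono_left inf_le_left)⟩

theorem exists_maximal_isEssentialIn [IsCompactlyGenerated α] (x : α) :
    ∃ e, Maximal (IsEssentialIn x) e := by
  have hchains (c : Set α) (hc : c ⊆ {e | IsEssentialIn x e}) (hchain : IsChain (· ≤ ·) c)
      (y : α) (hy : y ∈ c) : IsEssentialIn x (sSup c) := by
    refine ⟨(hc hy).1.trans (le_sSup hy), fun z hz hzx => ?_⟩
    rw [← inf_eq_left.2 hz, hchain.directedOn.inf_sSup_eq, iSup₂_eq_bot]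
    exact fun e he => (hc he).2 _ inf_le_right (hzx.mono_left inf_le_left)
  obtain ⟨e, -, he⟩ := zorn_le_nonempty₀ {e | IsEssentialIn x e}
    (fun c hc hchain y hy => ⟨sSup c, hchains c hc hchain y hy, fun _ => le_sSup⟩)
    x ⟨le_rfl, fun _ hy hyx => hyx.eq_bot_of_le hy⟩
  exact ⟨e, he⟩

theorem exists_maximal_disjoint [IsCompactlyGenerated α] (e : α) :
    ∃ c, Maximal (Disjoint · e) c := by
  obtain ⟨c, -, hc⟩ := zorn_le_nonempty₀ {c | Disjoint c e} (fun s hs hchain _ _ =>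
    ⟨sSup s, hchain.directedOn.disjoint_sSup_left.2 hs, fun _ => le_sSup⟩) ⊥ disjoint_bot_left
  exact ⟨c, hc⟩

end Lattice

section Module

variable {R : Type u} [Ring R]

/-- With `C` maximal disjoint from `E`, the embedding `E → J/C` is essential, so the image of an
extension `J/C → J` of the inclusion of `E` is an essential extension of `E`. -/
theorem exists_isProj_of_maximal_isEssentialIn {J : Type u} [AddCommGroup J] [Module R J]
    [Module.Injective R J] {X E : Submodule R J} (hE : Maximal (IsEssentialIn X) E) :
    ∃ h : J →ₗ[R] J, LinearMap.IsProj E h := by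
  obtain ⟨C, hC⟩ := exists_maximal_disjoint E
  have hinj : Function.Injective (C.mkQ ∘ₗ E.subtype) := by
    rw [← LinearMap.ker_eq_bot, LinearMap.ker_comp, Submodule.ker_mkQ]
    exact Submodule.disjoint_iff_comap_eq_bot.1 hC.prop.symm
  obtain ⟨g, hg⟩ := Module.Injective.out (C.mkQ ∘ₗ E.subtype) hinj E.subtype
  let h : J →ₗ[R] J := g ∘ₗ C.mkQ
  have hhE : ∀ x ∈ E, h x = x := fun x hx => hg ⟨x, hx⟩
  have hCh : C ≤ LinearMap.ker h := C.ker_mkQ.ge.trans (LinearMap.ker_le_ker_comp _ _)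
  have hrange : IsEssentialIn E (LinearMap.range h) := by
    refine ⟨fun x hx => ⟨x, hhE x hx⟩, fun N hN hNE => ?_⟩
    have hdisj : Disjoint (N.comap h) E := Submodule.disjoint_def.2 fun x hx hxE =>
      Submodule.disjoint_def.1 hNE x (hhE x hxE ▸ hx) hxE
    have hcomap : N.comap h ≤ C :=
      hC.le_of_ge hdisj (hCh.trans (Submodule.comap_mono bot_le))
    rw [← Submodule.map_comap_eq_of_le hN, ← le_bot_iff, Submodule.map_le_iff_le_comap]
    exact hcomap.trans hCh
  exact ⟨h, fun x => hE.le_of_ge (hE.prop.trans hrange) hrange.1 ⟨x, rfl⟩, hhE⟩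

theorem injective_of_isProj {J : Type u} [AddCommGroup J] [Module R J] [Module.Injective R J]
    {E : Submodule R J} {h : J →ₗ[R] J} (hh : LinearMap.IsProj E h) : Module.Injective R E := by
  rw [Module.injective_iff_injective_object]
  have : Injective (ModuleCat.of R J) := (Module.injective_iff_injective_object R J).1 inferInstance
  exact Retract.injective (Y := ModuleCat.of R J)
    ⟨ModuleCat.ofHom E.subtype, ModuleCat.ofHom hh.codRestrict, by
      ext x; exact congrArg Subtype.val (hh.codRestrict_apply_cod x)⟩

end Module

/-- A morphism `f : X ⟶ E` (usually a monomorphism) whose target is an essential extension of its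
image, expressed through morphisms out of `E` rather than through its subobjects. -/
def IsEssential {C : Type*} [Category C] {X E : C} (f : X ⟶ E) : Prop :=
  ∀ ⦃W : C⦄ (g : E ⟶ W), Mono (f ≫ g) → Mono g

variable {R : Type u} [Ring R]

theorem isEssential_iff_isEssentialIn {X E : ModuleCat.{u} R} (f : X ⟶ E) [Mono f] :
    IsEssential f ↔ IsEssentialIn (LinearMap.range f.hom) ⊤ := by
  have mono_comp_iff {W : ModuleCat.{u} R} (g : E ⟶ W) :
      Mono (f ≫ g) ↔ Disjoint (LinearMap.ker g.hom) (LinearMap.range f.hom) := by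
    have hf : Function.Injective f := (ModuleCat.mono_iff_injective f).1 inferInstance
    rw [ModuleCat.mono_iff_injective, disjoint_comm, LinearMap.disjoint_ker_iff_injOn]
    change Function.Injective (g ∘ f) ↔ Set.InjOn g (Set.range f)
    exact ⟨Function.Injective.injOn_range, fun h => (h.injective_iff _ subset_rfl).2 hf⟩
  refine ⟨fun hf => ⟨le_top, fun N _ hN => ?_⟩, fun hf W g hg => ?_⟩
  · have := (ModuleCat.mono_iff_ker_eq_bot _).1
      (hf (ModuleCat.ofHom N.mkQ) ((mono_comp_iff _).2 (by simpa using hN)))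
    simpa using this
  · exact (ModuleCat.mono_iff_ker_eq_bot g).2 (hf.2 _ le_top ((mono_comp_iff g).1 hg))

theorem exists_injectivePresentation_isEssential (X : ModuleCat.{u} R) :
    ∃ I : InjectivePresentation X, IsEssential I.f := by
  obtain ⟨J⟩ := EnoughInjectives.presentation X
  have : Module.Injective R J.J := (Module.injective_iff_injective_object R J.J).2 J.injective
  obtain ⟨E, hE⟩ := exists_maximal_isEssentialIn (LinearMap.range J.f.hom)
  obtain ⟨h, hh⟩ := exists_isProj_of_maximal_isEssentialIn hE
  have : Injective (ModuleCat.of R E) :=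
    (Module.injective_iff_injective_object R E).1 (injective_of_isProj hh)
  let f : X ⟶ ModuleCat.of R E :=
    ModuleCat.ofHom (J.f.hom.codRestrict E fun x => hE.prop.1 ⟨x, rfl⟩)
  have hf : f ≫ ModuleCat.ofHom E.subtype = J.f := rfl
  have : Mono f := mono_of_mono_fac hf
  refine ⟨⟨ModuleCat.of R E, inferInstance, f, inferInstance⟩,
    (isEssential_iff_isEssentialIn f).2 ⟨le_top, fun N _ hN => ?_⟩⟩
  have := hE.prop.2 (N.map E.subtype) (Submodule.map_subtype_le E N) (Submodule.disjoint_def.2 <| by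
    rintro _ ⟨y, hy, rfl⟩ ⟨x, hx⟩
    exact congrArg Subtype.val (Submodule.disjoint_def.1 hN y hy ⟨x, Subtype.ext hx⟩))
  exact Submodule.map_injective_of_injective E.injective_subtype
    (this.trans (Submodule.map_bot _).symm)

end EssentialExtension

section Coresolution

variable {C : Type*} [Category* C] [Abelian C]

theorem exists_shortComplex_hom {S S' : ShortComplex C} (hS : S.ShortExact) (a : S.X₁ ⟶ S'.X₁)
    (b : S.X₂ ⟶ S'.X₂) (w : a ≫ S'.f = S.f ≫ b) : ∃ φ : S ⟶ S', φ.τ₁ = a ∧ φ.τ₂ = b := by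
  have := hS.epi_g
  have hb : S.f ≫ b ≫ S'.g = 0 := by rw [← reassoc_of% w, S'.zero, comp_zero]
  exact ⟨⟨a, b, hS.exact.desc _ hb, w, (hS.exact.g_desc _ hb).symm⟩, rfl, rfl⟩

theorem exists_shortComplex_hom_of_injective {S S' : ShortComplex C} (hS : S.ShortExact)
    [Injective S'.X₂] (a : S.X₁ ⟶ S'.X₁) : ∃ φ : S ⟶ S', φ.τ₁ = a := by
  have := hS.mono_f
  obtain ⟨φ, hφ, -⟩ := exists_shortComplex_hom hS a _ (Injective.comp_factorThru _ S.f).symm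
  exact ⟨φ, hφ⟩

theorem IsEssential.nonempty_retract {S S' : ShortComplex C} (hf : IsEssential S.f)
    (hS : S.ShortExact) (hS' : S'.ShortExact) [Injective S.X₂] [Injective S'.X₂]
    (h : Retract S.X₁ S'.X₁) : Nonempty (Retract S S') := by
  have := hS.mono_f
  have := hS.epi_g
  obtain ⟨i, hi⟩ := exists_shortComplex_hom_of_injective hS (S' := S') h.i
  obtain ⟨r, hr⟩ := exists_shortComplex_hom_of_injective hS' (S' := S) h.r
  have hir : S.f ≫ (i ≫ r).τ₂ = S.f := by
    rw [← ShortComplex.Hom.comm₁₂, ShortComplex.comp_τ₁, hi, hr, h.retract, Category.id_comp]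
  have : Mono (i ≫ r).τ₂ := hf _ (by rw [hir]; infer_instance)
  let c : S.X₂ ⟶ S.X₂ := Injective.factorThru (𝟙 _) (i ≫ r).τ₂
  have hc : (i ≫ r).τ₂ ≫ c = 𝟙 _ := Injective.comp_factorThru _ _
  obtain ⟨φ, hφ₁, hφ₂⟩ := exists_shortComplex_hom (S' := S) hS (𝟙 _) c (by
    rw [Category.id_comp, ← hir, Category.assoc, hc, Category.comp_id, hir])
  have h₂ : (i ≫ r ≫ φ).τ₂ = 𝟙 _ := by
    rw [← hc, ← hφ₂, ← ShortComplex.comp_τ₂, Category.assoc]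
  refine ⟨⟨i, r ≫ φ, ShortComplex.hom_ext _ _ ?_ h₂ ?_⟩⟩
  · simp [hi, hr, hφ₁]
  · rw [← cancel_epi S.g, ← ShortComplex.Hom.comm₂₃, h₂]
    simp

/-- There is an exact sequence `0 ⟶ X ⟶ E⁰ ⟶ ⋯ ⟶ Eⁿ⁻¹` with terms `Eⁱ` in `Q`. -/
inductive HasCoresolution (Q : ObjectProperty C) : ℕ → C → Prop
  | zero (X : C) : HasCoresolution Q 0 X
  | succ {n : ℕ} {X E Z : C} {f : X ⟶ E} {g : E ⟶ Z} {w : f ≫ g = 0}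
      (shortExact : (ShortComplex.mk f g w).ShortExact) (prop : Q E)
      (next : HasCoresolution Q n Z) : HasCoresolution Q (n + 1) X

theorem HasCoresolution.of_mono {n : ℕ} {X E : C} (f : X ⟶ E) [Mono f] (hE : Q E)
    (h : HasCoresolution Q n (cokernel f)) : HasCoresolution Q (n + 1) X :=
  .succ (w := cokernel.condition f) { exact := ShortComplex.exact_cokernel f } hE h

theorem exact_comp_mono {X Y Z W : C} {f : X ⟶ Y} {g : Y ⟶ Z} {h : Z ⟶ W} {k : Y ⟶ W} [Mono h]
    {w : f ≫ g = 0} {w' : f ≫ k = 0} (hk : g ≫ h = k) (hfg : (ShortComplex.mk f g w).Exact) :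
    (ShortComplex.mk f k w').Exact := by
  let φ : ShortComplex.mk f g w ⟶ ShortComplex.mk f k w' := ⟨𝟙 _, 𝟙 _, h, by simp, by simp [hk]⟩
  have : Mono φ.τ₃ := ‹Mono h›
  exact (ShortComplex.exact_iff_of_epi_of_isIso_of_mono φ).1 hfg

theorem exact_epi_comp {X Y Z W : C} {f : X ⟶ Y} {g : Y ⟶ Z} {h : Z ⟶ W} {k : X ⟶ Z} [Epi f]
    {w : g ≫ h = 0} {w' : k ≫ h = 0} (hk : f ≫ g = k) :
    (ShortComplex.mk k h w').Exact ↔ (ShortComplex.mk g h w).Exact := by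
  let φ : ShortComplex.mk k h w' ⟶ ShortComplex.mk g h w := ⟨f, 𝟙 _, 𝟙 _, by simp [hk], by simp⟩
  have : Epi φ.τ₁ := ‹Epi f›
  exact ShortComplex.exact_iff_of_epi_of_isIso_of_mono φ

theorem quasiIso_fromSingle₀Equiv_symm {K : CochainComplex C ℕ} {X : C} {f : X ⟶ K.X 0}
    {w : f ≫ K.d 0 1 = 0} (hmono : Mono f) (hf : (ShortComplex.mk _ _ w).Exact)
    (hK : ∀ n, K.ExactAt (n + 1)) :
    QuasiIso ((CochainComplex.fromSingle₀Equiv K X).symm ⟨f, w⟩) where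
  quasiIsoAt n := by
    cases n with
    | zero =>
      rw [CochainComplex.quasiIsoAt₀_iff]
      refine (ShortComplex.quasiIso_iff_of_zeros _ rfl (by simp; rfl) (by simp; rfl)).2 ?_
      refine (ShortComplex.exact_and_mono_f_iff_of_iso ?_).2 ⟨hf, hmono⟩
      exact ShortComplex.isoMk (Iso.refl _) (Iso.refl _) (Iso.refl _)
        ((Category.id_comp _).trans <|
          (CochainComplex.fromSingle₀Equiv_symm_apply_f_zero f w).symm.trans
            (Category.comp_id _).symm)
        ((Category.id_comp _).trans (Category.comp_id _).symm)
    | succ n =>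
      rw [quasiIsoAt_iff_exactAt _ _ (CochainComplex.exactAt_succ_single_obj _ _)]
      exact hK n

section Splice

variable {Z J : ℕ → C} {i : ∀ n, Z n ⟶ J n} {p : ∀ n, J n ⟶ Z (n + 1)}

/-- The complex `J 0 ⟶ J 1 ⟶ ⋯` spliced from the complexes `Z n ⟶ J n ⟶ Z (n + 1)`. -/
noncomputable def spliceComplex (w : ∀ n, i n ≫ p n = 0) : CochainComplex C ℕ :=
  CochainComplex.of J (fun n => p n ≫ i (n + 1)) fun n => by
    rw [Category.assoc, reassoc_of% w (n + 1), zero_comp, comp_zero]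

theorem spliceComplex_d (w : ∀ n, i n ≫ p n = 0) (n : ℕ) :
    p n ≫ i (n + 1) = (spliceComplex w).d n (n + 1) :=
  (CochainComplex.of_d J (fun n => p n ≫ i (n + 1)) n).symm

theorem comp_spliceComplex_d (w : ∀ n, i n ≫ p n = 0) (n : ℕ) :
    i n ≫ (spliceComplex w).d n (n + 1) = 0 := by
  have : i n ≫ p n ≫ i (n + 1) = 0 := by rw [reassoc_of% w n, zero_comp]
  rwa [spliceComplex_d w n] at this

variable {w : ∀ n, i n ≫ p n = 0} (h : ∀ n, (ShortComplex.mk _ _ (w n)).ShortExact)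

include h

theorem exact_comp_spliceComplex_d (n : ℕ) :
    (ShortComplex.mk (i n) _ (comp_spliceComplex_d w n)).Exact :=
  have := (h (n + 1)).mono_f
  exact_comp_mono (h := i (n + 1)) (spliceComplex_d w n) (h n).exact

theorem exactAt_spliceComplex_succ (n : ℕ) : (spliceComplex w).ExactAt (n + 1) := by
  rw [HomologicalComplex.exactAt_iff' _ n (n + 1) (n + 2) (by simp) (by simp)]
  have : Epi (p n) := (h n).epi_g
  exact (exact_epi_comp (spliceComplex_d w n)).2 (exact_comp_spliceComplex_d h (n + 1))

/-- The injective resolution of `Z 0` spliced from short exact sequences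
`0 ⟶ Z n ⟶ J n ⟶ Z (n + 1) ⟶ 0` with injective middle terms. -/
noncomputable def spliceResolution (hJ : ∀ n, Injective (J n)) : InjectiveResolution (Z 0) where
  cocomplex := spliceComplex w
  injective := hJ
  ι := (CochainComplex.fromSingle₀Equiv _ _).symm ⟨i 0, comp_spliceComplex_d w 0⟩
  quasiIso :=
    quasiIso_fromSingle₀Equiv_symm (h 0).mono_f (exact_comp_spliceComplex_d h 0)
      (exactAt_spliceComplex_succ h)

end Splice

section Presentation

variable (P : ∀ X : C, InjectivePresentation X) {Q : ObjectProperty C}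

/-- The iterated cosyzygies of `X` formed with the injective presentations `P`. -/
noncomputable def cosyzygy (X : C) : ℕ → C
  | 0 => X
  | n + 1 => cokernel (P (cosyzygy X n)).f

/-- The injective resolution of `X` assembled from the injective presentations `P`. -/
noncomputable def resolutionOfPresentations (X : C) : InjectiveResolution X :=
  spliceResolution (Z := cosyzygy P X) (fun n => (P (cosyzygy P X n)).shortExact_shortComplex)
    fun n => (P (cosyzygy P X n)).injective

variable {P} (hP : ∀ X, IsEssential (P X).f) [Q.IsStableUnderRetracts] (hQ : Q ≤ isInjective C)

include hP hQ

theorem HasCoresolution.of_retract {n : ℕ} {X Y : C} (hY : HasCoresolution Q n Y)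
    (h : Retract X Y) : HasCoresolution Q n X := by
  induction hY generalizing X with
  | zero => exact .zero X
  | succ hS hE _ ih =>
    have := hQ _ hE
    obtain ⟨r⟩ := IsEssential.nonempty_retract (hP X) (P X).shortExact_shortComplex hS h
    exact .succ (P X).shortExact_shortComplex (Q.prop_of_retract (r.map ShortComplex.π₂) hE)
      (ih (r.map ShortComplex.π₃))

theorem HasCoresolution.presentation_succ {n : ℕ} {X : C} (h : HasCoresolution Q (n + 1) X) :
    Q (P X).J ∧ HasCoresolution Q n (cokernel (P X).f) := by
  cases h with
  | succ hS hE hZ =>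
    have := hQ _ hE
    obtain ⟨r⟩ :=
      IsEssential.nonempty_retract (hP X) (P X).shortExact_shortComplex hS (Retract.refl X)
    exact ⟨Q.prop_of_retract (r.map ShortComplex.π₂) hE,
      hZ.of_retract hP hQ (r.map ShortComplex.π₃)⟩

theorem HasCoresolution.cosyzygy {n : ℕ} (i : ℕ) {X : C} (h : HasCoresolution Q (i + n) X) :
    HasCoresolution Q n (cosyzygy P X i) := by
  induction i generalizing n with
  | zero => rwa [Nat.zero_add] at h
  | succ i ih =>
    exact (presentation_succ hP hQ (ih (n := n + 1) (by rwa [Nat.add_right_comm] at h))).2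

theorem HasCoresolution.resolutionOfPresentations {n : ℕ} {X : C} (h : HasCoresolution Q n X)
    {i : ℕ} (hi : i < n) : Q ((resolutionOfPresentations P X).cocomplex.X i) := by
  obtain ⟨k, rfl⟩ := Nat.exists_eq_add_of_lt hi
  change Q (P (DomDim.cosyzygy P X i)).J
  exact (presentation_succ hP hQ (h.cosyzygy hP hQ i)).1

end Presentation

section Extensions

theorem shortExact_map_cokernel {D : Type*} [Category* D] [HasZeroMorphisms D] (F : D ⥤ C)
    [F.PreservesZeroMorphisms] {X Y : D} (f : X ⟶ Y) [HasCokernel f]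
    [PreservesColimit (parallelPair f 0) F] [Mono (F.map f)] :
    (ShortComplex.mk (F.map f) (F.map (cokernel.π f))
      (by rw [← F.map_comp, cokernel.condition, F.map_zero])).ShortExact :=
  have h := isColimitCoforkMapOfIsColimit' F (cokernel.condition f) (cokernelIsCokernel f)
  { exact := ShortComplex.exact_of_g_is_cokernel _ h
    epi_g := epi_of_isColimit_cofork h }

theorem shortExact_cokernel {S S' : ShortComplex C} (hS : S.ShortExact) (hS' : S'.ShortExact)
    (φ : S ⟶ S') [Mono φ.τ₃] : (cokernel φ).ShortExact := by
  let D : ShortComplex.SnakeInput C :=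
    { L₀ := kernel φ
      L₁ := S
      L₂ := S'
      L₃ := cokernel φ
      v₀₁ := kernel.ι φ
      v₁₂ := φ
      v₂₃ := cokernel.π φ
      h₀ := kernelIsKernel φ
      h₃ := cokernelIsCokernel φ
      L₁_exact := hS.exact
      epi_L₁_g := hS.epi_g
      L₂_exact := hS'.exact
      mono_L₂_f := hS'.mono_f }
  have : Epi D.L₂.g := hS'.epi_g
  have : Mono D.v₁₂.τ₃ := ‹Mono φ.τ₃›
  have h₀ : IsZero D.L₀.X₃ := KernelFork.IsLimit.isZero_of_mono D.h₀τ₃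
  exact
    { exact := D.L₃_exact
      mono_f := (D.L₂'.exact_iff_mono (h₀.eq_zero_of_src _)).1 D.L₂'_exact
      epi_g := D.epi_L₃_g }

variable {Q : ObjectProperty C} {n : ℕ}

theorem HasCoresolution.of_iso {X Y : C} (h : HasCoresolution Q n X) (e : X ≅ Y) :
    HasCoresolution Q n Y := by
  cases h with
  | zero => exact .zero Y
  | @succ _ _ E Z f g w hS hE hZ =>
    exact .succ (w := by rw [Category.assoc, w, comp_zero]) (ShortComplex.shortExact_of_iso
      (ShortComplex.isoMk e (Iso.refl E) (Iso.refl Z) (S₂ := .mk (e.inv ≫ f) g _)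
        (by simp) (by simp)) hS) hE hZ

theorem nonempty_iso_of_shortExact {X Y Z Z' : C} {f : X ⟶ Y} {g : Y ⟶ Z} {g' : Y ⟶ Z'}
    {w : f ≫ g = 0} {w' : f ≫ g' = 0} (h : (ShortComplex.mk f g w).ShortExact)
    (h' : (ShortComplex.mk f g' w').ShortExact) : Nonempty (Z ≅ Z') :=
  ⟨h.gIsCokernel.coconePointUniqueUpToIso h'.gIsCokernel⟩

variable [Q.IsClosedUnderExtensions] {S : ShortComplex C} (hS : S.ShortExact)

open scoped ZeroObject

include hS

theorem HasCoresolution.X₂_of_shortExact (h₁ : HasCoresolution Q n S.X₁)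
    (h₃ : HasCoresolution Q n S.X₃) (hQ : Q ≤ isInjective C) : HasCoresolution Q n S.X₂ := by
  induction n generalizing S with
  | zero => exact .zero _
  | succ n ih =>
    obtain _ | @⟨_, _, E₁, Z₁, f₁, g₁, w₁, hf₁, hE₁, hZ₁⟩ := h₁
    obtain _ | @⟨_, _, E₃, Z₃, f₃, g₃, w₃, hf₃, hE₃, hZ₃⟩ := h₃
    have := hQ _ hE₁
    have := hS.mono_f
    have : Mono f₁ := hf₁.mono_f
    have : Mono f₃ := hf₃.mono_f
    have hS' := (ShortComplex.Splitting.ofHasBinaryBiproduct E₁ E₃).shortExact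
    let φ : S ⟶ .mk (biprod.inl : E₁ ⟶ E₁ ⊞ E₃) biprod.snd (by simp) :=
      { τ₁ := f₁
        τ₂ := biprod.lift (Injective.factorThru f₁ S.f) (S.g ≫ f₃)
        τ₃ := f₃
        comm₁₂ := by ext <;> simp
        comm₂₃ := by simp }
    have : Mono (ShortComplex.π₁.map φ) := ‹Mono f₁›
    have : Mono (ShortComplex.π₃.map φ) := ‹Mono f₃›
    have : Mono (ShortComplex.π₂.map φ) :=
      ShortComplex.mono_τ₂_of_exact_of_mono φ hS.exact
    obtain ⟨e₁⟩ := nonempty_iso_of_shortExact hf₁ (shortExact_map_cokernel ShortComplex.π₁ φ)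
    obtain ⟨e₃⟩ := nonempty_iso_of_shortExact hf₃ (shortExact_map_cokernel ShortComplex.π₃ φ)
    exact .succ (shortExact_map_cokernel ShortComplex.π₂ φ) (Q.prop_biprod hE₁ hE₃)
      (ih (shortExact_cokernel hS hS' φ) (hZ₁.of_iso e₁) (hZ₃.of_iso e₃))

theorem HasCoresolution.X₁_of_shortExact (h₂ : HasCoresolution Q (n + 1) S.X₂)
    (h₃ : HasCoresolution Q n S.X₃) (hQ : Q ≤ isInjective C) : HasCoresolution Q (n + 1) S.X₁ := by
  obtain _ | @⟨_, _, E, Z, f, g, w, hf, hE, hZ⟩ := h₂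
  have := hS.mono_f
  have := hf.mono_f
  have hid : (ShortComplex.mk (𝟙 S.X₁) (0 : S.X₁ ⟶ 0) comp_zero).ShortExact :=
    { exact := (ShortComplex.exact_iff_epi _ rfl).2 inferInstance }
  have hzero : (ShortComplex.mk (0 : 0 ⟶ Z) (𝟙 Z) zero_comp).ShortExact :=
    { exact := (ShortComplex.exact_iff_mono _ rfl).2 inferInstance }
  let φ : .mk (𝟙 S.X₁) (0 : S.X₁ ⟶ 0) comp_zero ⟶ ShortComplex.mk f g w :=
    { τ₁ := S.f
      τ₂ := S.f ≫ f
      τ₃ := 0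
      comm₂₃ := by simp [w] }
  have : Mono φ.τ₃ := inferInstanceAs (Mono (0 : (0 : C) ⟶ Z))
  have : Mono (ShortComplex.π₁.map φ) := ‹Mono S.f›
  have : Mono (ShortComplex.π₂.map φ) := mono_comp S.f f
  have : Mono (ShortComplex.π₃.map φ) := inferInstanceAs (Mono (0 : (0 : C) ⟶ Z))
  obtain ⟨e₁⟩ := nonempty_iso_of_shortExact hS (shortExact_map_cokernel ShortComplex.π₁ φ)
  obtain ⟨e₃⟩ := nonempty_iso_of_shortExact hzero (shortExact_map_cokernel ShortComplex.π₃ φ)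
  exact .succ (shortExact_map_cokernel ShortComplex.π₂ φ) hE
    (X₂_of_shortExact (shortExact_cokernel hid hf φ) (h₃.of_iso e₁) (hZ.of_iso e₃) hQ)

end Extensions

end Coresolution

section DominantDimension

variable {R : Type u} [Ring R]

theorem finite_of_epi {X Y : ModuleCat.{u} R} (f : X ⟶ Y) [Epi f] (hX : Module.Finite R X) :
    Module.Finite R Y :=
  Module.Finite.of_surjective (hM := hX) f.hom ((ModuleCat.epi_iff_surjective f).1 inferInstance)

theorem finite_of_mono [IsNoetherianRing R] {X Y : ModuleCat.{u} R} (f : X ⟶ Y) [Mono f]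
    (hY : Module.Finite R Y) : Module.Finite R X :=
  have : IsNoetherian R Y := @isNoetherian_of_isNoetherianRing_of_finite R Y _ _ _ _ hY
  Module.Finite.of_injective f.hom ((ModuleCat.mono_iff_injective f).1 inferInstance)

theorem finite_of_retract {X Y : ModuleCat.{u} R} (h : Retract X Y) (hY : Module.Finite R Y) :
    Module.Finite R X :=
  finite_of_epi h.r hY

instance : (proj R).IsStableUnderRetracts where
  of_retract h hY := ⟨finite_of_retract h hY.1, have := hY.2; h.projective⟩

variable (R) in
/-- The finitely generated modules that are both projective and injective. -/
def projInj : ObjectProperty (ModuleCat.{u} R) := proj R ⊓ isInjective _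

instance : (projInj R).IsStableUnderRetracts where
  of_retract h hY := ⟨(proj R).prop_of_retract h hY.1, have := hY.2; h.injective⟩

instance : (projInj R).IsClosedUnderExtensions where
  prop_X₂_of_shortExact {S} hS h₁ h₃ := by
    obtain ⟨⟨_, _⟩, _ : Injective S.X₁⟩ := h₁
    obtain ⟨⟨_, _⟩, _ : Injective S.X₃⟩ := h₃
    let e := hS.splittingOfInjective.isoBinaryBiproduct
    exact ⟨⟨Module.Finite.equiv (e ≪≫ ModuleCat.biprodIsoProd _ _).symm.toLinearEquiv,
      .of_iso e.symm inferInstance⟩, .of_iso e.symm inferInstance⟩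

theorem projInj_le_isInjective : projInj R ≤ isInjective (ModuleCat.{u} R) := inf_le_right

/-- An injective hull of `X`. -/
noncomputable def injectiveHull (X : ModuleCat.{u} R) : InjectivePresentation X :=
  (exists_injectivePresentation_isEssential X).choose

theorem isEssential_injectiveHull (X : ModuleCat.{u} R) : IsEssential (injectiveHull X).f :=
  (exists_injectivePresentation_isEssential X).choose_spec

theorem isMinimal_resolutionOfPresentations (X : ModuleCat.{u} R) :
    IsMinimal (resolutionOfPresentations injectiveHull X) := by
  intro n N hN
  have hker := (ShortComplex.moduleCat_exact_iff_range_eq_ker _).1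
    (exact_comp_spliceComplex_d
      (fun n => (injectiveHull (cosyzygy injectiveHull X n)).shortExact_shortComplex) n)
  refine ((isEssential_iff_isEssentialIn _).1
    (isEssential_injectiveHull (cosyzygy injectiveHull X n))).2 N le_top
    (disjoint_iff.2 (Eq.trans ?_ hN))
  exact congrArg (N ⊓ ·) hker

theorem HasCoresolution.le_domDim {n : ℕ} {X : ModuleCat.{u} R}
    (h : HasCoresolution (projInj R) n X) : (n : ℕ∞) ≤ domDim X :=
  le_iSup₂_of_le _ (isMinimal_resolutionOfPresentations X) <|
    le_iSup₂_of_le n (fun _ hi => (h.resolutionOfPresentations isEssential_injectiveHull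
      projInj_le_isInjective hi).1.2) le_rfl

theorem exists_finset_range_le_supported {N P α : Type*} [AddCommGroup N] [Module R N]
    [Module.Finite R N] [AddCommGroup P] [Module R P] (f : N →ₗ[R] (α →₀ P)) :
    ∃ F : Finset α, LinearMap.range f ≤ Finsupp.supported P R (F : Set α) := by
  classical
  obtain ⟨t, ht⟩ := Module.finite_def.1 ‹Module.Finite R N›
  refine ⟨t.biUnion fun x => (f x).support, ?_⟩
  rw [← Submodule.map_top, ← ht, Submodule.map_span_le]
  exact fun x hx => (Finsupp.mem_supported R _).2 <| Finset.coe_subset.2 <|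
    Finset.subset_biUnion_of_mem (fun x => (f x).support) hx

/- A projective module embeds into a free module, and a finite set of coordinates suffices to
separate the points of a finitely generated submodule, hence those of an essential extension. -/
theorem IsEssential.finite [IsNoetherianRing R] {X E : ModuleCat.{u} R} {f : X ⟶ E}
    (hf : IsEssential f) [Mono f] (hX : Module.Finite R X) [Projective E] : Module.Finite R E := by
  classical
  have : Module.Projective R E := (IsProjective.iff_projective E).2 ‹_›
  obtain ⟨s, hs⟩ := Module.projective_def.1 this
  obtain ⟨F, hF⟩ := exists_finset_range_le_supported (s ∘ₗ f.hom)
  let π := Finsupp.restrictDom R R (F : Set E)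
  have hπ (x : X) : (π (s (f x)) : E →₀ R) = s (f x) :=
    congrArg Subtype.val (LinearMap.congr_fun (Finsupp.restrictDom_comp_subtype _) ⟨_, hF ⟨x, rfl⟩⟩)
  let g : E ⟶ ModuleCat.of R (Finsupp.supported R R (F : Set E)) := ModuleCat.ofHom (π ∘ₗ s)
  have : Mono g := hf g <| (ModuleCat.mono_iff_injective _).2 fun x y hxy => by
    have hsf : s (f x) = s (f y) := by
      rw [← hπ x, ← hπ y]
      exact congrArg Subtype.val hxy
    exact (ModuleCat.mono_iff_injective f).1 inferInstance (Function.LeftInverse.injective hs hsf)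
  exact finite_of_mono g (Module.Finite.equiv (Finsupp.supportedEquivFinsupp (F : Set E)).symm)

theorem hasCoresolution_of_isMinimal [IsNoetherianRing R] {Y : ModuleCat.{u} R}
    (I : InjectiveResolution Y) (hI : IsMinimal I) {n : ℕ} (k : ℕ)
    (hproj : ∀ i < k + n, Projective (I.cocomplex.X i)) {X : ModuleCat.{u} R}
    (hX : Module.Finite R X) (f : X ⟶ I.cocomplex.X k) [Mono f]
    {w : f ≫ I.cocomplex.d k (k + 1) = 0} (hf : (ShortComplex.mk _ _ w).Exact) :
    HasCoresolution (projInj R) n X := by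
  induction n generalizing k X with
  | zero => exact .zero X
  | succ n ih =>
    have hess : IsEssential f := (isEssential_iff_isEssentialIn f).2 ⟨le_top, fun N _ hN =>
      hI k N ((congrArg (N ⊓ ·) ((ShortComplex.moduleCat_exact_iff_range_eq_ker _).1 hf)).symm.trans
        hN.eq_bot)⟩
    have := hproj k (by lia)
    have hE := hess.finite hX
    have hπ : cokernel.π f ≫ cokernel.desc f _ w = I.cocomplex.d k (k + 1) := cokernel.π_desc _ _ _
    have w' : cokernel.desc f _ w ≫ I.cocomplex.d (k + 1) (k + 2) = 0 := by
      rw [← cancel_epi (cokernel.π f), reassoc_of% hπ, HomologicalComplex.d_comp_d, comp_zero]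
    have : Mono (cokernel.desc f _ w) := hf.mono_cokernelDesc
    exact .succ (w := cokernel.condition f) ⟨ShortComplex.exact_cokernel f⟩
      ⟨⟨hE, inferInstance⟩, I.injective k⟩ (ih (k + 1) (fun i hi => hproj i (by lia))
        (finite_of_epi (cokernel.π f) hE) _ ((exact_epi_comp (w := w') hπ).1 (I.exact_succ k)))

theorem le_domDim_iff [IsNoetherianRing R] {X : ModuleCat.{u} R} (hX : Module.Finite R X) (n : ℕ) :
    (n : ℕ∞) ≤ domDim X ↔ HasCoresolution (projInj R) n X := by
  refine ⟨fun h => ?_, HasCoresolution.le_domDim⟩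
  cases n with
  | zero => exact .zero X
  | succ n =>
    have hlt : (n : ℕ∞) < domDim X := lt_of_lt_of_le (by exact_mod_cast n.lt_succ_self) h
    simp only [domDim, lt_iSup_iff, Nat.cast_lt] at hlt
    obtain ⟨I, hI, m, hm, hnm⟩ := hlt
    have hmono (j : ℕ) : Mono (I.ι.f j) := inferInstance
    let ι₀ : X ⟶ I.cocomplex.X 0 := I.ι.f 0
    have : Mono ι₀ := hmono 0
    exact hasCoresolution_of_isMinimal I hI 0 (fun i hi => hm i (by lia)) hX ι₀ I.exact₀

theorem domDim_le_of_iso {X Y : ModuleCat.{u} R} (e : X ≅ Y) : domDim X ≤ domDim Y :=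
  iSup₂_mono' fun I hI =>
    ⟨{ cocomplex := I.cocomplex
       injective := I.injective
       ι := ((CochainComplex.single₀ _).mapIso e.symm).hom ≫ I.ι }, hI, le_rfl⟩

theorem domDim_eq_of_iso {X Y : ModuleCat.{u} R} (e : X ≅ Y) : domDim X = domDim Y :=
  (domDim_le_of_iso e).antisymm (domDim_le_of_iso e.symm)

instance (d : ℕ) : (Dom R d).IsClosedUnderIsomorphisms where
  of_iso e := fun ⟨hX, hd⟩ => ⟨finite_of_epi e.hom hX, hd.trans (domDim_le_of_iso e)⟩

end DominantDimension

section Add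

variable {R : Type u} [Ring R]

theorem add_iff_exists_sum {M X : ModuleCat.{u} R} :
    add M X ↔ ∃ (n : ℕ) (a : Fin n → (X ⟶ M)) (b : Fin n → (M ⟶ X)), ∑ j, a j ≫ b j = 𝟙 X := by
  constructor
  · rintro ⟨n, ⟨h⟩⟩
    refine ⟨n, fun j => h.i ≫ ModuleCat.ofHom (LinearMap.proj j),
      fun j => ModuleCat.ofHom (LinearMap.single R (fun _ => M) j) ≫ h.r, ?_⟩
    have hsum : ∑ j, ModuleCat.ofHom (LinearMap.proj (φ := fun _ : Fin n => M) j) ≫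
        ModuleCat.ofHom (LinearMap.single R (fun _ => M) j) = 𝟙 (ModuleCat.of R (Fin n → M)) := by
      ext x i
      simp [ModuleCat.hom_sum, Finset.sum_pi_single]
    conv_rhs => rw [← h.retract, ← Category.id_comp h.r, ← hsum]
    simp only [Preadditive.comp_sum, Preadditive.sum_comp, Category.assoc]
  · rintro ⟨n, a, b, hab⟩
    refine ⟨n, ⟨⟨ModuleCat.ofHom (LinearMap.pi fun j => (a j).hom),
      ModuleCat.ofHom (∑ j, (b j).hom ∘ₗ LinearMap.proj j), ?_⟩⟩⟩
    rw [← hab]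
    ext x
    simp [ModuleCat.hom_sum, LinearMap.sum_apply]

instance (M : ModuleCat.{u} R) : (add M).IsStableUnderRetracts where
  of_retract h := fun ⟨n, ⟨h'⟩⟩ => ⟨n, ⟨h.trans h'⟩⟩

theorem add_self (M : ModuleCat.{u} R) : add M M :=
  add_iff_exists_sum.2 ⟨1, fun _ => 𝟙 M, fun _ => 𝟙 M, by simp⟩

theorem add_of_iso {M N : ModuleCat.{u} R} (e : M ≅ N) : add N M :=
  (add N).prop_of_iso e.symm (add_self N)

theorem add_trans {M N X : ModuleCat.{u} R} (hM : add N M) (hX : add M X) : add N X := by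
  obtain ⟨n, a, b, hab⟩ := add_iff_exists_sum.1 hX
  obtain ⟨m, c, d, hcd⟩ := add_iff_exists_sum.1 hM
  let e := finProdFinEquiv (m := n) (n := m)
  refine add_iff_exists_sum.2 ⟨n * m, fun k => a (e.symm k).1 ≫ c (e.symm k).2,
    fun k => d (e.symm k).2 ≫ b (e.symm k).1, ?_⟩
  rw [← hab, ← e.sum_comp, Fintype.sum_prod_type]
  refine Finset.sum_congr rfl fun i _ => ?_
  rw [← Category.id_comp (b i), ← hcd]
  simp only [Equiv.symm_apply_apply, Preadditive.comp_sum, Preadditive.sum_comp, Category.assoc]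

theorem add_map {S : Type u} [Ring S] {M X : ModuleCat.{u} R}
    (F : ModuleCat.{u} R ⥤ ModuleCat.{u} S) [F.Additive] (h : add M X) :
    add (F.obj M) (F.obj X) := by
  obtain ⟨n, a, b, hab⟩ := add_iff_exists_sum.1 h
  refine add_iff_exists_sum.2 ⟨n, fun j => F.map (a j), fun j => F.map (b j), ?_⟩
  simp only [← F.map_comp, ← Functor.map_sum, hab, F.map_id]

theorem isIso_app_of_add {D : Type*} [Category* D] [Preadditive D] {F G : ModuleCat.{u} R ⥤ D}
    [F.Additive] [G.Additive] (α : F ⟶ G) {M X : ModuleCat.{u} R} (h : add M X)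
    [IsIso (α.app M)] : IsIso (α.app X) := by
  obtain ⟨n, a, b, hab⟩ := add_iff_exists_sum.1 h
  refine ⟨∑ j, G.map (a j) ≫ inv (α.app M) ≫ F.map (b j), ?_, ?_⟩
  · simp only [Preadditive.comp_sum, ← NatTrans.naturality_assoc, IsIso.hom_inv_id_assoc,
      ← F.map_comp, ← F.map_sum, hab, F.map_id]
  · simp only [Preadditive.sum_comp, Category.assoc, NatTrans.naturality,
      IsIso.inv_hom_id_assoc, ← G.map_comp, ← G.map_sum, hab, G.map_id]

theorem finite_of_add {M X : ModuleCat.{u} R} (hM : Module.Finite R M) (h : add M X) :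
    Module.Finite R X := by
  obtain ⟨n, ⟨h⟩⟩ := h
  exact finite_of_retract h (inferInstanceAs (Module.Finite R (Fin n → M)))

theorem injective_of_add {M X : ModuleCat.{u} R} [Injective M] (h : add M X) : Injective X := by
  obtain ⟨n, ⟨h⟩⟩ := h
  have : Module.Injective R M := (Module.injective_iff_injective_object R M).2 inferInstance
  have : Injective (ModuleCat.of R (Fin n → M)) :=
    (Module.injective_iff_injective_object R _).1 inferInstance
  exact h.injective

theorem exists_epi_pi {X : ModuleCat.{u} R} (hX : Module.Finite R X) :
    ∃ (n : ℕ) (f : ModuleCat.of R (Fin n → R) ⟶ X), Epi f := by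
  obtain ⟨n, f, hf⟩ := Module.Finite.exists_fin' R X
  exact ⟨n, ModuleCat.ofHom f, (ModuleCat.epi_iff_surjective _).2 hf⟩

theorem proj_pi (n : ℕ) : proj R (ModuleCat.of R (Fin n → R)) :=
  ⟨inferInstanceAs (Module.Finite R (Fin n → R)),
    (IsProjective.iff_projective _).1 (inferInstanceAs (Module.Projective R (Fin n → R)))⟩

theorem proj_iff_add {X : ModuleCat.{u} R} : proj R X ↔ add (ModuleCat.of R R) X := by
  refine ⟨fun ⟨hfin, hproj⟩ => ?_, fun ⟨n, ⟨h⟩⟩ => (proj R).prop_of_retract h (proj_pi n)⟩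
  obtain ⟨n, f, hf⟩ := exists_epi_pi hfin
  exact ⟨n, ⟨⟨Projective.factorThru (𝟙 X) f, f, Projective.factorThru_comp _ _⟩⟩⟩

theorem isSeparator_of_add {M : ModuleCat.{u} R} (h : add M (ModuleCat.of R R)) :
    IsSeparator M := by
  obtain ⟨n, a, b, hab⟩ := add_iff_exists_sum.1 h
  refine (isSeparator_def _).2 fun X Y f g hfg => ?_
  ext x
  let φ : ModuleCat.of R R ⟶ X := ModuleCat.ofHom (LinearMap.toSpanSingleton R X x)
  have hφ : φ ≫ f = φ ≫ g := by
    rw [← Category.id_comp φ, ← hab]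
    simp only [Preadditive.sum_comp, Category.assoc, hfg]
  simpa [φ] using congr($hφ (1 : R))

end Add

section ExtVanishing

section Abelian

variable {C : Type*} [Category* C] [Abelian C] [HasExt.{w} C] {S : ShortComplex C}
  (hS : S.ShortExact) {A : C}

include hS

theorem subsingleton_ext_X₁ {i : ℕ} (h₃ : Subsingleton (Ext A S.X₃ i))
    (h₂ : Subsingleton (Ext A S.X₂ (i + 1))) : Subsingleton (Ext A S.X₁ (i + 1)) := by
  refine subsingleton_of_forall_eq 0 fun e => ?_
  obtain ⟨x, rfl⟩ := Ext.covariant_sequence_exact₁ A hS e (Subsingleton.elim _ _) rfl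
  rw [Subsingleton.elim x 0, Ext.zero_comp]

theorem subsingleton_ext_X₃ {i : ℕ} (h₂ : Subsingleton (Ext A S.X₂ i))
    (h₁ : Subsingleton (Ext A S.X₁ (i + 1))) : Subsingleton (Ext A S.X₃ i) := by
  refine subsingleton_of_forall_eq 0 fun e => ?_
  obtain ⟨x, rfl⟩ := Ext.covariant_sequence_exact₃ A hS e rfl (Subsingleton.elim _ _)
  rw [Subsingleton.elim x 0, Ext.zero_comp]

theorem exists_lift_of_subsingleton_ext (h : Subsingleton (Ext A S.X₁ 1)) (f : A ⟶ S.X₃) :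
    ∃ g : A ⟶ S.X₂, g ≫ S.g = f := by
  obtain ⟨x, hx⟩ := Ext.covariant_sequence_exact₃ A hS (Ext.mk₀ f) (zero_add 1)
    (Subsingleton.elim _ _)
  obtain ⟨g, rfl⟩ := Ext.homEquiv₀.symm.surjective x
  exact ⟨g, Ext.homEquiv₀.symm.injective (by simpa using hx)⟩

theorem subsingleton_ext_one_of_lift (h₂ : Subsingleton (Ext A S.X₂ 1))
    (h : ∀ f : A ⟶ S.X₃, ∃ g : A ⟶ S.X₂, g ≫ S.g = f) : Subsingleton (Ext A S.X₁ 1) := by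
  refine subsingleton_of_forall_eq 0 fun e => ?_
  obtain ⟨x, rfl⟩ := Ext.covariant_sequence_exact₁ A hS e (Subsingleton.elim _ _) (zero_add 1)
  obtain ⟨f, rfl⟩ := Ext.homEquiv₀.symm.surjective x
  obtain ⟨g, rfl⟩ := h f
  simp [← Ext.mk₀_comp_mk₀, Ext.comp_assoc_of_second_deg_zero]

end Abelian

variable {R : Type u} [Ring R] {M X Y : ModuleCat.{u} R}

theorem subsingleton_ext_of_add_left {i : ℕ} (hY : add M Y) (h : Subsingleton (Ext M X i)) :
    Subsingleton (Ext Y X i) := by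
  obtain ⟨n, a, b, hab⟩ := add_iff_exists_sum.1 hY
  refine subsingleton_of_forall_eq 0 fun e => ?_
  rw [← e.mk₀_id_comp, ← hab, Ext.mk₀_sum, Ext.sum_comp]
  refine Finset.sum_eq_zero fun j _ => ?_
  rw [← Ext.mk₀_comp_mk₀, Ext.comp_assoc_of_second_deg_zero,
    Subsingleton.elim ((Ext.mk₀ (b j)).comp e (zero_add i)) 0, Ext.comp_zero]

theorem subsingleton_ext_of_add_right {i : ℕ} (hY : add M Y) (h : Subsingleton (Ext X M i)) :
    Subsingleton (Ext X Y i) := by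
  obtain ⟨n, a, b, hab⟩ := add_iff_exists_sum.1 hY
  refine subsingleton_of_forall_eq 0 fun e => ?_
  rw [← e.comp_mk₀_id, ← hab, Ext.mk₀_sum, Ext.comp_sum]
  refine Finset.sum_eq_zero fun j _ => ?_
  rw [← Ext.mk₀_comp_mk₀, ← Ext.comp_assoc_of_second_deg_zero,
    Subsingleton.elim (e.comp (Ext.mk₀ (a j)) (add_zero i)) 0, Ext.zero_comp]

theorem rightPerp_add_iff {n : ℕ} : rightPerp (add M) n X ↔
    Module.Finite R X ∧ ∀ i, 1 ≤ i → i ≤ n → Subsingleton (Ext M X i) :=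
  ⟨fun h => ⟨h.1, h.2 M (add_self M)⟩, fun h => ⟨h.1, fun _ hY i hi hin =>
    subsingleton_ext_of_add_left hY (h.2 i hi hin)⟩⟩

theorem rightPerp_antitone (P : ObjectProperty (ModuleCat.{u} R)) : Antitone (rightPerp P) :=
  fun _ _ hmn _ hX => ⟨hX.1, fun Y hY i hi him => hX.2 Y hY i hi (him.trans hmn)⟩

end ExtVanishing

section GlobalDimension

variable {R : Type u} [Ring R]

theorem glDim_le_iff {n : ℕ} : glDim R ≤ n ↔
    ∀ X : ModuleCat.{u} R, Module.Finite R X → HasProjectiveDimensionLE X n := by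
  simp only [glDim, iSup_le_iff, projectiveDimension_le_iff]

theorem HasCoresolution.hasProjectiveDimensionLE {m j : ℕ} {X : ModuleCat.{u} R}
    (hX : HasCoresolution (projInj R) m X) (hfin : Module.Finite R X)
    (h : glDim R ≤ (m + j : ℕ)) : HasProjectiveDimensionLE X j := by
  induction m generalizing j X with
  | zero => exact glDim_le_iff.1 (by rwa [Nat.zero_add] at h) X hfin
  | succ m ih =>
    obtain _ | @⟨_, _, E, Z, f, g, w, hfg, ⟨⟨hE, _⟩, _⟩, hZ⟩ := hX
    have := hfg.epi_g
    exact hfg.hasProjectiveDimensionLT_X₁ (j + 1)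
      (hasProjectiveDimensionLT_of_ge E 1 (j + 1) (by lia))
      (ih (j := j + 1) hZ (finite_of_epi g hE) (by rwa [Nat.add_right_comm] at h))

theorem HasCoresolution.projective {m : ℕ} {X : ModuleCat.{u} R}
    (hX : HasCoresolution (projInj R) m X) (hfin : Module.Finite R X) (h : glDim R ≤ m) :
    Projective X :=
  projective_iff_hasProjectiveDimensionLT_one.2 (hX.hasProjectiveDimensionLE (j := 0) hfin h)

theorem HasCoresolution.injective {m : ℕ} {X : ModuleCat.{u} R}
    (hX : HasCoresolution (projInj R) (m + 1) X) (h : glDim R ≤ m) : Injective X := by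
  obtain _ | @⟨_, _, E, Z, f, g, w, hfg, ⟨⟨hE, _⟩, _ : Injective E⟩, hZ⟩ := hX
  have := hfg.epi_g
  have := hZ.projective (finite_of_epi g hE) h
  exact (Retract.mk f _ hfg.splittingOfProjective.f_r).injective

theorem exists_shortExact_proj [IsNoetherianRing R] {X : ModuleCat.{u} R}
    (hX : Module.Finite R X) : ∃ (K P : ModuleCat.{u} R) (i : K ⟶ P) (p : P ⟶ X) (w : i ≫ p = 0),
      (ShortComplex.mk i p w).ShortExact ∧ proj R P ∧ Module.Finite R K := by
  obtain ⟨n, f, hf⟩ := exists_epi_pi hX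
  exact ⟨_, _, kernel.ι f, f, kernel.condition f, { exact := ShortComplex.exact_kernel f },
    proj_pi n, finite_of_mono (kernel.ι f) (proj_pi n).1⟩

theorem projective_of_hasProjectiveDimensionLE [IsNoetherianRing R]
    (hR : proj R ≤ isInjective (ModuleCat.{u} R)) {m : ℕ} {X : ModuleCat.{u} R}
    (hX : Module.Finite R X) (h : HasProjectiveDimensionLE X m) : Projective X := by
  induction m generalizing X with
  | zero => exact projective_iff_hasProjectiveDimensionLT_one.2 h
  | succ m ih =>
    obtain ⟨K, P, i, p, w, hip, ⟨_, _⟩, hK⟩ := exists_shortExact_proj hX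
    have hKP : Projective K := ih hK (hip.hasProjectiveDimensionLT_X₁ (m + 1)
      (hasProjectiveDimensionLT_of_ge P 1 (m + 1) (by lia)) h)
    have : Injective K := hR K ⟨hK, hKP⟩
    exact (Retract.mk _ p hip.splittingOfInjective.s_g).projective

theorem isSemisimpleRing_of_glDim_le_zero (h : glDim R ≤ 0) : IsSemisimpleRing R where
  exists_isCompl J := by
    have hJ : Module.Projective R (R ⧸ J) := (IsProjective.iff_projective _).2
      (projective_iff_hasProjectiveDimensionLT_one.2
        (glDim_le_iff.1 h (ModuleCat.of R (R ⧸ J)) inferInstance))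
    have hsplit := (LinearMap.exact_subtype_mkQ J).split_tfae J.injective_subtype J.mkQ_surjective
    obtain ⟨r, hr⟩ := (hsplit.out 0 1).1
      (Module.projective_lifting_property J.mkQ LinearMap.id J.mkQ_surjective)
    exact ⟨_, LinearMap.isCompl_of_proj (LinearMap.congr_fun hr)⟩

theorem isSemisimpleRing_of_lt_domDim [IsNoetherianRing R] {m : ℕ} (hgl : glDim R ≤ m)
    (hdom : m < domDim (ModuleCat.of R R)) : IsSemisimpleRing R := by
  have hfin : Module.Finite R (ModuleCat.of R R) := inferInstanceAs (Module.Finite R R)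
  have hcores := (le_domDim_iff hfin (m + 1)).1 (by exact_mod_cast Order.add_one_le_of_lt hdom)
  have := hcores.injective hgl
  refine isSemisimpleRing_of_glDim_le_zero (glDim_le_iff.2 fun X hX => ?_)
  exact projective_iff_hasProjectiveDimensionLT_one.1 (projective_of_hasProjectiveDimensionLE
    (fun Y hY => injective_of_add (proj_iff_add.1 hY)) hX (glDim_le_iff.1 hgl X hX))

theorem HasCoresolution.of_add {n : ℕ} {M X : ModuleCat.{u} R}
    (hM : HasCoresolution (projInj R) n M) (hX : add M X) : HasCoresolution (projInj R) n X := by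
  obtain ⟨k, ⟨r⟩⟩ := hX
  refine HasCoresolution.of_retract isEssential_injectiveHull projInj_le_isInjective ?_ r
  clear r
  induction k with
  | zero =>
    have hzero : IsZero (ModuleCat.of R (Fin 0 → M)) := ModuleCat.isZero_of_subsingleton _
    exact hM.of_retract isEssential_injectiveHull projInj_le_isInjective
      ⟨0, 0, hzero.eq_of_src _ _⟩
  | succ k ih =>
    exact (X₂_of_shortExact (ShortComplex.Splitting.ofHasBinaryBiproduct M _).shortExact hM ih
      projInj_le_isInjective).of_iso
        (ModuleCat.biprodIsoProd _ _ ≪≫ (Fin.consLinearEquiv R fun _ => M).toModuleIso)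

variable [IsNoetherianRing R] {d : ℕ}

theorem proj_le_Dom (h : d ≤ domDim (ModuleCat.of R R)) : proj R ≤ Dom R d := by
  have hfin : Module.Finite R (ModuleCat.of R R) := inferInstanceAs (Module.Finite R R)
  exact fun X hX => ⟨hX.1,
    (((le_domDim_iff hfin d).1 h).of_add (proj_iff_add.1 hX)).le_domDim⟩

theorem Dom_le_proj (h : glDim R ≤ d) : Dom R d ≤ proj R :=
  fun _ hX => ⟨hX.1, ((le_domDim_iff hX.1 d).1 hX.2).projective hX.1 h⟩

theorem hasProjectiveDimensionLE_of_le_domDim (h : proj R = Dom R d) {j k : ℕ} (hjk : j + k = d)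
    {X : ModuleCat.{u} R} (hX : Module.Finite R X) (hj : j ≤ domDim X) :
    HasProjectiveDimensionLE X k := by
  induction k generalizing j X with
  | zero =>
    obtain rfl : j = d := hjk
    have hX' : proj R X := h ▸ ⟨hX, hj⟩
    exact projective_iff_hasProjectiveDimensionLT_one.1 hX'.2
  | succ k ih =>
    obtain ⟨K, P, i, p, w, hip, hP, hK⟩ := exists_shortExact_proj hX
    have hPd : (d : ℕ∞) ≤ domDim P := (h ▸ hP : Dom R d P).2
    have hPj := (le_domDim_iff hP.1 (j + 1)).1 (le_trans (by exact_mod_cast (by lia)) hPd)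
    have hKj := (HasCoresolution.X₁_of_shortExact hip hPj ((le_domDim_iff hX j).1 hj)
      projInj_le_isInjective).le_domDim
    have := hP.2
    exact hip.hasProjectiveDimensionLT_X₃ (k + 1) (ih (by lia) hK hKj)
      (hasProjectiveDimensionLT_of_ge P 1 (k + 2) (by lia))

theorem proj_eq_Dom_iff (hR : ¬ IsSemisimpleRing R) :
    proj R = Dom R d ↔ domDim (ModuleCat.of R R) = d ∧ glDim R = d := by
  constructor
  · intro h
    have hdom : (d : ℕ∞) ≤ domDim (ModuleCat.of R R) :=
      (h ▸ proj_iff_add.2 (add_self _) : Dom R d (ModuleCat.of R R)).2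
    have hgl : glDim R ≤ d := glDim_le_iff.2 fun X hX =>
      hasProjectiveDimensionLE_of_le_domDim h (Nat.zero_add d) hX (by simp)
    refine ⟨hdom.antisymm' (not_lt.1 fun hlt => hR (isSemisimpleRing_of_lt_domDim hgl hlt)),
      hgl.antisymm (not_lt.1 fun hlt => hR ?_)⟩
    cases d with
    | zero => exact isSemisimpleRing_of_glDim_le_zero hlt.le
    | succ m =>
      have hm : glDim R ≤ m := ENat.WithBot.lt_add_one_iff.1 hlt
      exact isSemisimpleRing_of_lt_domDim hm
        (lt_of_lt_of_le (by exact_mod_cast m.lt_succ_self) hdom)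
  · rintro ⟨hdom, hgl⟩
    exact (proj_le_Dom hdom.ge).antisymm (Dom_le_proj hgl.le)

end GlobalDimension

section Units

variable {C : Type u} [Category.{w} C] {G : C ⥤ C} (α : 𝟭 C ⟶ G)

theorem mono_app_of_mono {X E : C} (f : X ⟶ E) [Mono f] [Mono (α.app E)] : Mono (α.app X) := by
  have : Mono (α.app X ≫ G.map f) := by
    rw [← α.naturality]
    exact mono_comp f (α.app E)
  exact mono_of_mono _ (G.map f)

theorem epi_map_of_epi {X Y : C} (f : X ⟶ Y) [Epi f] [Epi (α.app Y)] : Epi (G.map f) := by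
  have : Epi (α.app X ≫ G.map f) := by
    rw [← α.naturality]
    exact epi_comp f (α.app Y)
  exact epi_of_epi (α.app X) _

variable [Abelian C]

theorem isIso_app_X₁ [G.PreservesZeroMorphisms] [G.PreservesMonomorphisms] {S : ShortComplex C}
    (hS : S.ShortExact) [IsIso (α.app S.X₂)] [Mono (α.app S.X₃)] : IsIso (α.app S.X₁) := by
  have := hS.mono_f
  have hzero : (G.map S.f ≫ inv (α.app S.X₂)) ≫ S.g = 0 := by
    refine (cancel_mono (α.app S.X₃)).1 ?_
    have hg : S.g ≫ α.app S.X₃ = α.app S.X₂ ≫ G.map S.g := α.naturality S.g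
    rw [Category.assoc, Category.assoc, hg, IsIso.inv_hom_id_assoc, ← G.map_comp, S.zero,
      G.map_zero, zero_comp]
  let β : G.obj S.X₁ ⟶ S.X₁ := hS.exact.lift _ hzero
  have hβ : β ≫ S.f = G.map S.f ≫ inv (α.app S.X₂) := hS.exact.lift_f _ hzero
  have hf : S.f ≫ α.app S.X₂ = α.app S.X₁ ≫ G.map S.f := α.naturality S.f
  refine ⟨β, (cancel_mono S.f).1 ?_, (cancel_mono (G.map S.f)).1 ?_⟩
  · simp only [Category.assoc, hβ, ← reassoc_of% hf, IsIso.hom_inv_id, Category.comp_id,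
      Functor.id_obj, Category.id_comp]
  · simp only [Category.assoc, ← hf, reassoc_of% hβ, IsIso.inv_hom_id, Category.comp_id,
      Category.id_comp]

variable {Q : ObjectProperty C} (hα : ∀ E, Q E → IsIso (α.app E)) {n : ℕ} {X : C}

include hα

theorem HasCoresolution.mono_app (hX : HasCoresolution Q (n + 1) X) : Mono (α.app X) := by
  obtain _ | @⟨_, _, E, _, f, _, _, hfg, hE, -⟩ := hX
  have := hfg.mono_f
  have := hα E hE
  exact mono_app_of_mono α f

theorem HasCoresolution.isIso_app [G.PreservesZeroMorphisms] [G.PreservesMonomorphisms]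
    (hX : HasCoresolution Q (n + 2) X) : IsIso (α.app X) := by
  obtain _ | @⟨_, _, E, _, _, _, _, hfg, hE, hZ⟩ := hX
  have := hα E hE
  have := hZ.mono_app α hα
  exact isIso_app_X₁ α hfg

end Units

section Separators

theorem epi_iff_forall_exists_lift {C : Type u} [Category.{w} C] {P X Y : C} [Projective P]
    (hP : IsSeparator P) (g : X ⟶ Y) : Epi g ↔ ∀ f : P ⟶ Y, ∃ f' : P ⟶ X, f' ≫ g = f := by
  refine ⟨fun _ f => ⟨Projective.factorThru f g, Projective.factorThru_comp f g⟩, fun h => ⟨?_⟩⟩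
  intro W a b hab
  refine hP.def _ _ fun f => ?_
  obtain ⟨f', rfl⟩ := h f
  rw [Category.assoc, Category.assoc, hab]

end Separators

/-- A fully faithful functor `F` with an exact left adjoint `T` that sends the finitely generated
`R`-module `M` to the regular `S`-module, where every finitely generated `R`-module embeds into an
injective module in `add M`. The model case is `F = Hom(M, -)` with `S` the opposite of the
endomorphism ring of a generator-cogenerator `M`; only these properties of it enter the argument. -/
structure MoritaTachikawaContext {R : Type u} [Ring R] (M : ModuleCat.{u} R) (S : Type u)
    [Ring S] where
  F : ModuleCat.{u} R ⥤ ModuleCat.{u} S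
  T : ModuleCat.{u} S ⥤ ModuleCat.{u} R
  adj : T ⊣ F
  full : F.Full
  faithful : F.Faithful
  preservesFiniteLimits : PreservesFiniteLimits T
  isoRegular : F.obj M ≅ ModuleCat.of S S
  finite : Module.Finite R M
  exists_injective : ∀ X : ModuleCat.{u} R, Module.Finite R X →
    ∃ (I : ModuleCat.{u} R) (f : X ⟶ I), Mono f ∧ Injective I ∧ add M I

namespace MoritaTachikawaContext

variable {R : Type u} [Ring R] {M : ModuleCat.{u} R} {S : Type u} [Ring S]
  (c : MoritaTachikawaContext M S)

attribute [instance] full faithful preservesFiniteLimits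

instance : PreservesLimitsOfSize.{0, 0} c.F := c.adj.rightAdjoint_preservesLimits
instance : PreservesColimitsOfSize.{0, 0} c.T := c.adj.leftAdjoint_preservesColimits
instance : PreservesFiniteLimits c.F := PreservesLimitsOfSize.preservesFiniteLimits _
instance : PreservesFiniteColimits c.T := PreservesColimitsOfSize.preservesFiniteColimits _
instance : c.F.Additive := Functor.additive_of_preserves_binary_products _
instance : c.T.Additive := c.adj.left_adjoint_additive
instance : c.F.PreservesInjectiveObjects :=
  Functor.preservesInjectiveObjects_of_adjunction_of_preservesMonomorphisms c.adj

theorem add_F_of_proj {Y : ModuleCat.{u} S} (hY : proj S Y) : add (c.F.obj M) Y :=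
  add_trans (add_of_iso c.isoRegular.symm) (proj_iff_add.1 hY)

theorem isIso_unit_of_proj {Y : ModuleCat.{u} S} (hY : proj S Y) : IsIso (c.adj.unit.app Y) :=
  isIso_app_of_add c.adj.unit (c.add_F_of_proj hY)

theorem add_T_of_proj {Y : ModuleCat.{u} S} (hY : proj S Y) : add M (c.T.obj Y) :=
  add_trans (add_of_iso (asIso (c.adj.counit.app M))) (add_map c.T (c.add_F_of_proj hY))

theorem proj_F_iff {X : ModuleCat.{u} R} : proj S (c.F.obj X) ↔ add M X :=
  ⟨fun h => (add M).prop_of_iso (asIso (c.adj.counit.app X)) (c.add_T_of_proj h),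
    fun h => proj_iff_add.2 (add_trans (add_of_iso c.isoRegular) (add_map c.F h))⟩

theorem finite_T {Y : ModuleCat.{u} S} (hY : Module.Finite S Y) :
    Module.Finite R (c.T.obj Y) := by
  obtain ⟨n, f, hf⟩ := exists_epi_pi hY
  exact finite_of_epi (c.T.map f) (finite_of_add c.finite (c.add_T_of_proj (proj_pi n)))

theorem injective_T {E : ModuleCat.{u} S} (hE : projInj S E) : Injective (c.T.obj E) := by
  have := c.isIso_unit_of_proj hE.1
  exact c.F.injective_of_map_injective (Injective.of_iso (asIso (c.adj.unit.app E)) hE.2)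

theorem epi_F_map_iff {X Y : ModuleCat.{u} R} (g : X ⟶ Y) :
    Epi (c.F.map g) ↔ ∀ f : M ⟶ Y, ∃ f' : M ⟶ X, f' ≫ g = f := by
  have hproj : Projective (c.F.obj M) := (c.proj_F_iff.2 (add_self M)).2
  have hsep : IsSeparator (c.F.obj M) := isSeparator_of_add (add_of_iso c.isoRegular.symm)
  rw [epi_iff_forall_exists_lift hsep, c.F.map_surjective.forall]
  refine forall_congr' fun f => ?_
  rw [c.F.map_surjective.exists]
  simp only [← c.F.map_comp, c.F.map_injective.eq_iff]

theorem epi_F_map_iff_subsingleton_ext {C : ShortComplex (ModuleCat.{u} R)} (hC : C.ShortExact)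
    (h : Subsingleton (Ext M C.X₂ 1)) : Epi (c.F.map C.g) ↔ Subsingleton (Ext M C.X₁ 1) := by
  rw [epi_F_map_iff]
  exact ⟨subsingleton_ext_one_of_lift hC h, exists_lift_of_subsingleton_ext hC⟩

theorem shortExact_F {C : ShortComplex (ModuleCat.{u} R)} (hC : C.ShortExact)
    (h : Epi (c.F.map C.g)) : (C.map c.F).ShortExact :=
  have := hC.mono_f
  { exact := hC.exact.map_of_mono_of_preservesKernel c.F hC.mono_f inferInstance
    mono_f := inferInstanceAs (Mono (c.F.map C.f))
    epi_g := h }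

include c in
theorem exists_shortExact_injective {X : ModuleCat.{u} R} (hX : Module.Finite R X) :
    ∃ (I Z : ModuleCat.{u} R) (f : X ⟶ I) (g : I ⟶ Z) (w : f ≫ g = 0),
      (ShortComplex.mk f g w).ShortExact ∧ Injective I ∧ add M I ∧ Module.Finite R Z := by
  obtain ⟨I, f, _, hI, hI'⟩ := c.exists_injective X hX
  exact ⟨I, _, f, cokernel.π f, cokernel.condition f, { exact := ShortComplex.exact_cokernel f },
    hI, hI', finite_of_epi (cokernel.π f) (finite_of_add c.finite hI')⟩

theorem hasCoresolution_two_F {C : ShortComplex (ModuleCat.{u} R)} (hC : C.ShortExact)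
    [Injective C.X₂] (h₂ : add M C.X₂) (h₃ : Module.Finite R C.X₃) :
    HasCoresolution (projInj S) 2 (c.F.obj C.X₁) := by
  obtain ⟨J, g, hg, hJ, hJ'⟩ := c.exists_injective C.X₃ h₃
  have := hC.mono_f
  have hex : (C.map c.F).Exact :=
    hC.exact.map_of_mono_of_preservesKernel c.F hC.mono_f inferInstance
  let ι : cokernel (c.F.map C.f) ⟶ c.F.obj C.X₃ := cokernel.desc _ _ (C.map c.F).zero
  have : Mono ι := hex.mono_cokernelDesc
  exact .of_mono (c.F.map C.f) ⟨c.proj_F_iff.2 h₂, c.F.injective_obj C.X₂⟩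
    (.of_mono (ι ≫ c.F.map g) ⟨c.proj_F_iff.2 hJ', c.F.injective_obj J⟩ (.zero _))

theorem hasCoresolution_F {n : ℕ} {X : ModuleCat.{u} R} (hX : rightPerp (add M) n X) :
    HasCoresolution (projInj S) (n + 2) (c.F.obj X) := by
  induction n generalizing X with
  | zero =>
    obtain ⟨I, Z, f, g, w, hfg, hI, hIM, hZ⟩ := c.exists_shortExact_injective hX.1
    exact c.hasCoresolution_two_F hfg hIM hZ
  | succ n ih =>
    obtain ⟨hfin, hext⟩ := rightPerp_add_iff.1 hX
    obtain ⟨I, Z, f, g, w, hfg, hI, hIM, hZ⟩ := c.exists_shortExact_injective hfin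
    have hepi := (c.epi_F_map_iff_subsingleton_ext hfg
      (HasInjectiveDimensionLT.subsingleton I 1 1 le_rfl M)).2 (hext 1 le_rfl (by lia))
    have hZext (i : ℕ) (hi : 1 ≤ i) (hin : i ≤ n) : Subsingleton (Ext M Z i) :=
      subsingleton_ext_X₃ hfg (HasInjectiveDimensionLT.subsingleton I 1 i hi M)
        (hext (i + 1) (by lia) (by lia))
    exact .succ (c.shortExact_F hfg hepi) ⟨c.proj_F_iff.2 hIM, c.F.injective_obj I⟩
      (ih (rightPerp_add_iff.2 ⟨hZ, hZext⟩))

theorem isIso_unit_of_hasCoresolution {n : ℕ} {Y : ModuleCat.{u} S}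
    (hY : HasCoresolution (projInj S) (n + 2) Y) : IsIso (c.adj.unit.app Y) :=
  hY.isIso_app c.adj.unit fun _ hE => c.isIso_unit_of_proj hE.1

theorem subsingleton_ext_T {n : ℕ} {Y : ModuleCat.{u} S}
    (hY : HasCoresolution (projInj S) (n + 2) Y) (i : ℕ) (hi : 1 ≤ i) (hin : i ≤ n) :
    Subsingleton (Ext M (c.T.obj Y) i) := by
  induction n generalizing Y i with
  | zero => lia
  | succ n ih =>
    obtain _ | @⟨_, _, E, Z, f, g, w, hfg, hE, hZ⟩ := hY
    have := c.injective_T hE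
    have hT : ((ShortComplex.mk f g w).map c.T).ShortExact := hfg.map_of_exact c.T
    obtain ⟨i, rfl⟩ := Nat.exists_eq_add_of_le' hi
    rcases Nat.eq_zero_or_pos i with rfl | hi'
    · have := hfg.epi_g
      have := c.isIso_unit_of_hasCoresolution hZ
      have : Epi (c.adj.unit.app Z) := IsIso.epi_of_iso _
      exact (c.epi_F_map_iff_subsingleton_ext hT
        (HasInjectiveDimensionLT.subsingleton (c.T.obj E) 1 1 le_rfl M)).1
        (epi_map_of_epi c.adj.unit g)
    · exact subsingleton_ext_X₁ hT (ih hZ i hi' (by lia))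
        (HasInjectiveDimensionLT.subsingleton (c.T.obj E) 1 (i + 1) (by lia) M)

section Noetherian

variable [IsNoetherianRing S]

theorem finite_F_iff {X : ModuleCat.{u} R} : Module.Finite S (c.F.obj X) ↔ Module.Finite R X := by
  refine ⟨fun h => finite_of_epi (c.adj.counit.app X) (c.finite_T h), fun h => ?_⟩
  obtain ⟨I, f, _, -, hI⟩ := c.exists_injective X h
  exact finite_of_mono (c.F.map f) (c.proj_F_iff.2 hI).1

-- `F` detects finite generation, which passes to submodules over the Noetherian ring `S`.
include c in
theorem finite_of_mono {X Y : ModuleCat.{u} R} (f : X ⟶ Y) [Mono f] (hY : Module.Finite R Y) :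
    Module.Finite R X :=
  c.finite_F_iff.1 (DomDim.finite_of_mono (c.F.map f) (c.finite_F_iff.2 hY))

theorem Dom_F_iff {n : ℕ} {X : ModuleCat.{u} R} :
    Dom S (n + 2) (c.F.obj X) ↔ rightPerp (add M) n X := by
  constructor
  · rintro ⟨hfin, hdom⟩
    refine rightPerp_add_iff.2 ⟨c.finite_F_iff.1 hfin, fun i hi hin => ?_⟩
    exact subsingleton_ext_of_add_right (add_of_iso (asIso (c.adj.counit.app X)).symm)
      (c.subsingleton_ext_T ((le_domDim_iff hfin (n + 2)).1 hdom) i hi hin)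
  · exact fun hX => ⟨c.finite_F_iff.2 hX.1, (c.hasCoresolution_F hX).le_domDim⟩

theorem isIso_unit_of_Dom {n : ℕ} {Y : ModuleCat.{u} S} (hY : Dom S (n + 2) Y) :
    IsIso (c.adj.unit.app Y) :=
  c.isIso_unit_of_hasCoresolution ((le_domDim_iff hY.1 (n + 2)).1 hY.2)

include c in
theorem proj_eq_Dom_iff {n : ℕ} : proj S = Dom S (n + 2) ↔ add M = rightPerp (add M) n := by
  refine ⟨fun h => by ext X; rw [← c.proj_F_iff, h, c.Dom_F_iff], fun h => ?_⟩
  have hF (X : ModuleCat.{u} R) : proj S (c.F.obj X) ↔ Dom S (n + 2) (c.F.obj X) := by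
    rw [c.proj_F_iff, h, c.Dom_F_iff]
  ext Y
  constructor
  · intro hY
    have := c.isIso_unit_of_proj hY
    have e := asIso (c.adj.unit.app Y)
    exact (Dom S (n + 2)).prop_of_iso e.symm ((hF _).1 ((proj S).prop_of_iso e hY))
  · intro hY
    have := c.isIso_unit_of_Dom hY
    have e := asIso (c.adj.unit.app Y)
    exact (proj S).prop_of_iso e.symm ((hF _).2 ((Dom S (n + 2)).prop_of_iso e hY))

include c

theorem exists_approximation {X : ModuleCat.{u} R} (hX : Module.Finite R X) :
    ∃ (N : ModuleCat.{u} R) (p : N ⟶ X), add M N ∧ Epi p ∧ Epi (c.F.map p) := by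
  obtain ⟨n, f, hf⟩ := exists_epi_pi (c.finite_F_iff.2 hX)
  let p := (c.adj.homEquiv _ X).symm f
  have hp : c.adj.unit.app _ ≫ c.F.map p = f :=
    (c.adj.homEquiv_unit _ _ p).symm.trans ((c.adj.homEquiv _ X).apply_symm_apply f)
  have : Epi (c.F.map p) := epi_of_epi_fac hp
  exact ⟨_, p, c.add_T_of_proj (proj_pi n), c.F.epi_of_epi_map this, this⟩

theorem exists_shortExact_approximation {n : ℕ} {X : ModuleCat.{u} R}
    (hM : rightPerp (add M) (n + 1) M) (hX : rightPerp (add M) n X) :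
    ∃ (X' N : ModuleCat.{u} R) (f : X' ⟶ N) (p : N ⟶ X) (w : f ≫ p = 0),
      (ShortComplex.mk f p w).ShortExact ∧ add M N ∧ rightPerp (add M) (n + 1) X' := by
  obtain ⟨N, p, hN, hp, hFp⟩ := c.exists_approximation hX.1
  have hC : (ShortComplex.mk _ _ (kernel.condition p)).ShortExact :=
    { exact := ShortComplex.exact_kernel p }
  have hNext (i : ℕ) (hi : 1 ≤ i) (hin : i ≤ n + 1) : Subsingleton (Ext M N i) :=
    subsingleton_ext_of_add_right hN (hM.2 M (add_self M) i hi hin)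
  refine ⟨_, N, _, p, _, hC, hN, rightPerp_add_iff.2
    ⟨c.finite_of_mono (kernel.ι p) (finite_of_add c.finite hN), fun i hi hin => ?_⟩⟩
  obtain ⟨i, rfl⟩ := Nat.exists_eq_add_of_le' hi
  rcases Nat.eq_zero_or_pos i with rfl | hi'
  · exact (c.epi_F_map_iff_subsingleton_ext hC (hNext 1 le_rfl (by lia))).1 hFp
  · exact subsingleton_ext_X₁ hC (hX.2 M (add_self M) i hi' (by lia)) (hNext _ hi hin)

theorem subsingleton_ext_of_leftPerp {n : ℕ} (h : add M = rightPerp (add M) n)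
    {W : ModuleCat.{u} R} (hW : leftPerp (add M) n W) {j : ℕ} (hj : j ≤ n) {X : ModuleCat.{u} R}
    (hX : rightPerp (add M) j X) (i : ℕ) (hi : 1 ≤ i) (hij : i ≤ j) : Subsingleton (Ext W X i) := by
  induction hj using Nat.decreasingInduction generalizing X i with
  | self => exact hW.2 X (h ▸ hX) i hi hij
  | of_succ j hj ih =>
    have hM : rightPerp (add M) (j + 1) M := rightPerp_antitone _ hj M (h ▸ add_self M)
    obtain ⟨X', N, f, p, w, hfp, hN, hX'⟩ := c.exists_shortExact_approximation hM hX
    exact subsingleton_ext_X₃ hfp (hW.2 N hN i hi (by lia)) (ih hX' (i + 1) (by lia) (by lia))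

theorem add_eq_leftPerp {n : ℕ} (h : add M = rightPerp (add M) n) :
    add M = leftPerp (add M) n := by
  have hM : rightPerp (add M) n M := h ▸ add_self M
  ext X
  constructor
  · exact fun hX => ⟨finite_of_add c.finite hX, fun Y hY i hi hin =>
      subsingleton_ext_of_add_left hX ((h ▸ hY : rightPerp (add M) n Y).2 M (add_self M) i hi hin)⟩
  · intro hX
    cases n with
    | zero => exact h ▸ ⟨hX.1, by lia⟩
    | succ n =>
      obtain ⟨X', N, f, p, w, hfp, hN, hX'⟩ := c.exists_shortExact_approximation
        (rightPerp_antitone _ (by lia) M hM) (rightPerp_add_iff.2 ⟨hX.1, by lia⟩ : rightPerp _ 0 X)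
      obtain ⟨s, hs⟩ := exists_lift_of_subsingleton_ext hfp
        (c.subsingleton_ext_of_leftPerp h hX (by lia) hX' 1 le_rfl le_rfl) (𝟙 X)
      exact (add M).prop_of_retract ⟨s, p, hs⟩ hN

theorem proj_eq_Dom_iff_isMaximalOrthogonal {n : ℕ} :
    proj S = Dom S (n + 2) ↔ IsMaximalOrthogonal M n :=
  c.proj_eq_Dom_iff.trans ⟨fun h => ⟨h, c.add_eq_leftPerp h⟩, And.left⟩

end Noetherian

include c in
theorem isSemisimpleRing [IsSemisimpleRing S] : IsSemisimpleRing R where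
  exists_isCompl J := by
    let j : ModuleCat.of R J ⟶ ModuleCat.of R R := ModuleCat.ofHom J.subtype
    have : Mono j := (ModuleCat.mono_iff_injective _).2 J.injective_subtype
    have : Injective (c.F.obj (ModuleCat.of R J)) :=
      (Module.injective_iff_injective_object S _).1 (Module.injective_of_isSemisimpleRing S _)
    let r := c.F.preimage (Injective.factorThru (𝟙 _) (c.F.map j))
    have hr : j ≫ r = 𝟙 _ := c.F.map_injective <| by
      rw [c.F.map_comp, c.F.map_preimage, Injective.comp_factorThru, c.F.map_id]
    exact ⟨_, LinearMap.isCompl_of_proj fun x => congr($hr x)⟩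

end MoritaTachikawaContext

section FiniteAlgebras

variable (K : Type w) [CommRing K] {R : Type u} [Ring R] [Algebra K R] [Module.Finite K R]

theorem isNoetherianRing_end_op [IsNoetherianRing K] (M : Type u) [AddCommGroup M] [Module R M]
    [Module.Finite R M] : IsNoetherianRing (Module.End R M)ᵐᵒᵖ := by
  let _ : Module K M := Module.restrictScalars K R M
  have : IsScalarTower K R M := IsScalarTower.restrictScalars K R M
  have : SMulCommClass R K M := IsScalarTower.to_smulCommClass'
  have : Module.Finite K M := Module.Finite.trans R M
  have : Module.Finite K (Module.End R M) :=
    Module.Finite.of_injective (LinearMap.restrictScalarsₗ K R M M K)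
      (LinearMap.restrictScalars_injective K)
  exact IsNoetherianRing.of_finite K _

theorem finite_restrictScalars_obj {X : ModuleCat.{u} R} (hX : Module.Finite R X) :
    Module.Finite K ((ModuleCat.restrictScalars (algebraMap K R)).obj X) := by
  let _ : Module K X := Module.restrictScalars K R X
  have : IsScalarTower K R X := IsScalarTower.restrictScalars K R X
  exact Module.Finite.trans (R := K) R X

theorem finite_coextendScalars_obj [IsNoetherianRing K] {Y : ModuleCat.{u} K}
    (hY : Module.Finite K Y) :
    Module.Finite R ((ModuleCat.coextendScalars (algebraMap K R)).obj Y) := by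
  let H := (ModuleCat.restrictScalars (algebraMap K R)).obj (ModuleCat.of R R) →ₗ[K] Y
  have : Module.Finite K ((ModuleCat.restrictScalars (algebraMap K R)).obj (ModuleCat.of R R)) :=
    finite_restrictScalars_obj K (inferInstanceAs (Module.Finite R R))
  have : IsScalarTower K R H := ⟨fun k r f => LinearMap.ext fun (s : R) => by
    have : s * (k • r) = algebraMap K R k * (s * r) := by
      rw [mul_smul_comm, Algebra.smul_def]
    exact (congrArg f this).trans (f.map_smul k (s * r))⟩
  have : Module.Finite K H := Module.IsNoetherian.finite K H
  have : Module.Finite R H := Module.Finite.of_restrictScalars_finite K R H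
  exact Module.Finite.equiv (ModuleCat.CoextendScalars.equiv (algebraMap K R) Y).symm

theorem exists_mono_injective_finite [IsSemisimpleRing K] {X : ModuleCat.{u} R}
    (hX : Module.Finite R X) :
    ∃ (I : ModuleCat.{u} R) (f : X ⟶ I), Mono f ∧ Injective I ∧ Module.Finite R I := by
  let adj := ModuleCat.restrictCoextendScalarsAdj.{u} (algebraMap K R)
  let Y : ModuleCat.{u} K := (ModuleCat.restrictScalars (algebraMap K R)).obj X
  have : Injective Y :=
    (Module.injective_iff_injective_object K Y).1 (Module.injective_of_isSemisimpleRing K Y)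
  exact ⟨_, adj.unit.app X, inferInstance, Injective.injective_of_adjoint adj Y,
    finite_coextendScalars_obj K (finite_restrictScalars_obj K hX)⟩

end FiniteAlgebras

section GeneratorCogenerators

variable {R : Type u} [Ring R]

theorem IsGenerator.add_of_proj {M X : ModuleCat.{u} R} (hM : IsGenerator M) (hX : proj R X) :
    add M X := by
  obtain ⟨n, f, hf⟩ := hM X hX.1
  have := hX.2
  have : Epi (ModuleCat.ofHom f) := (ModuleCat.epi_iff_surjective _).2 hf
  exact ⟨n, ⟨⟨Projective.factorThru (𝟙 X) (ModuleCat.ofHom f), ModuleCat.ofHom f,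
    Projective.factorThru_comp _ _⟩⟩⟩

theorem IsCogenerator.add_of_injective {M I : ModuleCat.{u} R} (hM : IsCogenerator M)
    (hI : Module.Finite R I) [Injective I] : add M I := by
  obtain ⟨n, f, hf⟩ := hM I hI
  have : Mono (ModuleCat.ofHom f) := (ModuleCat.mono_iff_injective _).2 hf
  exact ⟨n, ⟨⟨ModuleCat.ofHom f, Injective.factorThru (𝟙 _) (ModuleCat.ofHom f),
    Injective.comp_factorThru _ _⟩⟩⟩

variable (M : Type u) [AddCommGroup M] [Module R M]

/-- The equivalence between modules over the opposites of the two forms of the endomorphism ring of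
`M`: the ring of linear maps and the endomorphism ring of an object of `ModuleCat R`. -/
noncomputable def endOpModuleEquivalence :
    ModuleCat.{u} (CategoryTheory.End (ModuleCat.of R M))ᵐᵒᵖ ≌
      ModuleCat.{u} (Module.End R M)ᵐᵒᵖ :=
  ModuleCat.restrictScalarsEquivalenceOfRingEquiv
    (ModuleCat.endRingEquiv (ModuleCat.of R M)).symm.op

/-- The functor `Hom(M, -)`. The endomorphisms of `M` act on `Hom(M, X)` from the right, by
precomposition, whence the opposite ring. -/
noncomputable def homFunctor : ModuleCat.{u} R ⥤ ModuleCat.{u} (Module.End R M)ᵐᵒᵖ :=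
  preadditiveCoyonedaObj (ModuleCat.of R M) ⋙ (endOpModuleEquivalence M).functor

noncomputable def homFunctorObjIso : (homFunctor M).obj (ModuleCat.of R M) ≅
    ModuleCat.of (Module.End R M)ᵐᵒᵖ (Module.End R M)ᵐᵒᵖ :=
  let e : (homFunctor M).obj (ModuleCat.of R M) ≃ₗ[(Module.End R M)ᵐᵒᵖ] (Module.End R M)ᵐᵒᵖ :=
    { (ModuleCat.homAddEquiv (M := ModuleCat.of R M) (N := ModuleCat.of R M)).trans
        MulOpposite.opAddEquiv with
      map_smul' := fun _ _ => rfl }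
  e.toModuleIso

/-- The Morita–Tachikawa correspondence of a generator-cogenerator `M`: by the Gabriel–Popescu
theorem, `Hom(M, -)` is fully faithful with an exact left adjoint. -/
noncomputable def MoritaTachikawaContext.ofIsGenerator [Module.Finite R M]
    (hM : IsGenerator (ModuleCat.of R M))
    (hinj : ∀ X : ModuleCat.{u} R, Module.Finite R X →
      ∃ (I : ModuleCat.{u} R) (f : X ⟶ I), Mono f ∧ Injective I ∧ add (ModuleCat.of R M) I) :
    MoritaTachikawaContext (ModuleCat.of R M) (Module.End R M)ᵐᵒᵖ :=
  have hsep : IsSeparator (ModuleCat.of R M) :=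
    isSeparator_of_add (hM.add_of_proj (proj_iff_add.2 (add_self _)))
  have := IsGrothendieckAbelian.GabrielPopescu.full _ hsep
  have := (isSeparator_iff_faithful_preadditiveCoyonedaObj _).1 hsep
  have := IsGrothendieckAbelian.GabrielPopescu.preservesFiniteLimits _ hsep
  { F := homFunctor M
    T := (endOpModuleEquivalence M).inverse ⋙
      IsGrothendieckAbelian.tensorObj (ModuleCat.of R M)
    adj := (endOpModuleEquivalence M).symm.toAdjunction.comp
      (IsGrothendieckAbelian.tensorObjPreadditiveCoyonedaObjAdjunction _)
    full := Functor.Full.comp _ _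
    faithful := Functor.Faithful.comp _ _
    preservesFiniteLimits := comp_preservesFiniteLimits _ _
    isoRegular := homFunctorObjIso M
    finite := ‹_›
    exists_injective := hinj }

theorem algDomDim_eq (A : Type u) [Ring A] :
    algDomDim A = domDim (ModuleCat.of Aᵐᵒᵖ Aᵐᵒᵖ) :=
  domDim_eq_of_iso <|
    LinearEquiv.toModuleIso { MulOpposite.opAddEquiv with map_smul' := fun _ _ => rfl }

end GeneratorCogenerators

end DomDim

theorem mainTheorem7_general {R : Type u} [Ring R] (hR : ¬ IsSemisimpleRing R)
    (M : Type u) [AddCommGroup M] [Module R M] [Module.Finite R M]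
    [IsNoetherianRing (Module.End R M)ᵐᵒᵖ]
    (hgen : DomDim.IsGenerator (ModuleCat.of R M)) (hcog : DomDim.IsCogenerator (ModuleCat.of R M))
    (hinj : ∀ X : ModuleCat.{u} R, Module.Finite R X →
      ∃ (I : ModuleCat.{u} R) (f : X ⟶ I),
        CategoryTheory.Mono f ∧ CategoryTheory.Injective I ∧ Module.Finite R I)
    (d : ℕ) (hd : 2 ≤ d) :
    List.TFAE
      [DomDim.proj (Module.End R M)ᵐᵒᵖ = DomDim.Dom (Module.End R M)ᵐᵒᵖ d,
        DomDim.algDomDim (Module.End R M) = (d : ℕ∞) ∧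
          DomDim.glDim (Module.End R M)ᵐᵒᵖ = (d : WithBot ℕ∞),
        DomDim.IsMaximalOrthogonal (ModuleCat.of R M) (d - 2)] := by
  obtain ⟨n, rfl⟩ := Nat.exists_eq_add_of_le' hd
  let c := DomDim.MoritaTachikawaContext.ofIsGenerator M hgen fun X hX => by
    obtain ⟨I, f, hf, hI, hfin⟩ := hinj X hX
    exact ⟨I, f, hf, hI, hcog.add_of_injective hfin⟩
  have hS : ¬ IsSemisimpleRing (Module.End R M)ᵐᵒᵖ := fun _ => hR c.isSemisimpleRing
  tfae_have 1 ↔ 2 := by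
    rw [DomDim.algDomDim_eq]
    exact DomDim.proj_eq_Dom_iff hS
  tfae_have 1 ↔ 3 := c.proj_eq_Dom_iff_isMaximalOrthogonal
  tfae_finish

theorem mainTheorem7
    {K : Type w} [Field K]
    -- a finite dimensional, non-semisimple algebra
    {B : Type u} [Ring B] [Algebra K B] [Module.Finite K B] (hB : ¬ IsSemisimpleRing B)
    -- a finite dimensional right module that is a generator-cogenerator
    (M : Type u) [AddCommGroup M] [Module Bᵐᵒᵖ M] [Module.Finite Bᵐᵒᵖ M]
    (hgen : DomDim.IsGenerator (ModuleCat.of Bᵐᵒᵖ M))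
    (hcog : DomDim.IsCogenerator (ModuleCat.of Bᵐᵒᵖ M))
    (d : ℕ) (hd : 2 ≤ d) :
    List.TFAE
      [DomDim.proj (Module.End Bᵐᵒᵖ M)ᵐᵒᵖ = DomDim.Dom (Module.End Bᵐᵒᵖ M)ᵐᵒᵖ d,
        DomDim.algDomDim (Module.End Bᵐᵒᵖ M) = (d : ℕ∞) ∧
          DomDim.glDim (Module.End Bᵐᵒᵖ M)ᵐᵒᵖ = (d : WithBot ℕ∞),
        DomDim.IsMaximalOrthogonal (ModuleCat.of Bᵐᵒᵖ M) (d - 2)] :=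
  have := DomDim.isNoetherianRing_end_op K (R := Bᵐᵒᵖ) M
  mainTheorem7_general (mt isSemisimpleRing_mulOpposite_iff.1 hB) M hgen hcog
    (fun _ hX => DomDim.exists_mono_injective_finite K hX) d hd
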